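/- **Dimension functions.** A dimension function is a map $\Phi:(0,1)\to[0,\infty)$ such that $t^{1+\Phi(t)}$ decreases to $0$ as $t\downarrow 0$ and, for some $T,C>0$, $(2t)^{1+\Phi(2t)}\le C\,t^{1+\Phi(t)}$ for all $0<t<T$. It is large if, for $t$ near $0$, $\Phi(t)=H(t)\,\log|\log t|/|\log t|$ with $H(t)\to\infty$ as $t\to0$. Let $\mathcal N_r(E)$ be the least number of open balls of radius $r$ covering $E$. For a set $E$, $\overline{\dim}_\Phi E$ is the infimum (resp. $\underline{\dim}_\Phi E$ the supremum) of the $d\in\mathbb R$ for which there are $C_1,C_2>0$ such that, for all $0<r\le R^{1+\Phi(R)}<R<C_1$ and all $z\in E$, $\mathcal N_r(B(z,R)\cap E)\le C_2(R/r)^d$ (resp. $\ge$). For a Borel probability measure $\mu$, $\overline{\dim}_\Phi\mu$ is the infimum (resp. $\underline{\dim}_\Phi\mu$ the supremum) of the $d\in\mathbb R$ for which there are $C_1,C_2>0$ such that, for all $0<r<R^{1+\Phi(R)}\le R\le C_1$ and all $x\in\operatorname{supp}\mu$, $\mu(B(x,R))/\mu(B(x,r))\le C_2(R/r)^d$ (resp.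 $\ge$). **Model.** Fix an integer $K\ge2$ and $A,B,\tau>0$ with $KA\le B<1$ and $\tau\le(1-B)/K$. Let $(\mathcal A,\mathcal Q)$ be a probability space and, for each $u\in\mathcal A$, let $S_1(u),\dots,S_K(u)$ be similarities mapping $[0,1]$ into itself, with scaling ratios $a(i,u)$ measurable in $u$, such that $A\le a(i,u)$ for all $i$, $\sum_{i=1}^K a(i,u)\le B$, and $\operatorname{dist}(S_i(u)[0,1],S_j(u)[0,1])\ge\tau$ for $i\ne j$. For $\mathbf u=(u_n)_{n\ge1}\in\mathcal A^{\mathbb N}$ put $I_{i_1,\dots,i_n}(\mathbf u)=S_{i_1}(u_1)\circ\cdots\circ S_{i_n}(u_n)[0,1]$ and let the random Moran set be $F_{\mathbf u}=\bigcap_n\bigcup_{i_1,\dots,i_n}I_{i_1,\dots,i_n}(\mathbf u)$, where $\mathbf u$ has law $\mathcal Q^{\mathbb N}$. Let $\mathcal W=\{p\in\mathbb R^K:p_i\ge0,\ \sum_ip_i=1\}$. Call a probability measure $\mathbb P$ on $\mathcal A\times\mathcal W$ admissible if its marginal on $\mathcal A$ is $\mathcal Q$ and, for some $t>0$, $\int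 p_i^{-t}\,d\mathbb P(u,p)<\infty$ for all $i$ (with $0^{-t}=\infty$). For a sequence $\boldsymbol\lambda=(u_n,p_n)_{n\ge1}$ of law $\mathbb P^{\mathbb N}$, the associated random measure $\mu_{\boldsymbol\lambda}$ is the Borel probability measure with $\mu_{\boldsymbol\lambda}(I_{i_1,\dots,i_n}(\mathbf u))=p_1(i_1)\cdots p_n(i_n)$ for all $n$ and $i_1,\dots,i_n$. **Theorem.** The equation $\int\log\big(\sum_{i=1}^Ka(i,u)^x\big)\,d\mathcal Q(u)=0$ has a unique solution $x=D\in\mathbb R$, and for every large dimension function $\Phi$: 1. for $\mathcal Q^{\mathbb N}$-almost every $\mathbf u$, $\ \overline{\dim}_\Phi F_{\mathbf u}=\underline{\dim}_\Phi F_{\mathbf u}=\dim_HF_{\mathbf u}=D$; 2. $D$ is the maximum of $\underline{\dim}_\Phi\mu_{\boldsymbol\lambda}$ and the minimum of $\overline{\dim}_\Phi\mu_{\boldsymbol\lambda}$ over the associated random measures, that is: for every admissible $\mathbb P$, $\ \underline{\dim}_\Phi\mu_{\boldsymbol\lambda}\le D\le\overline{\dim}_\Phi\mu_{\boldsymbol\lambda}$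 for $\mathbb P^{\mathbb N}$-almost every $\boldsymbol\lambda$; $D$ is the greatest number that is the $\mathbb P^{\mathbb N}$-almost sure value of $\underline{\dim}_\Phi\mu_{\boldsymbol\lambda}$ for some admissible $\mathbb P$; and $D$ is the least number that is the $\mathbb P^{\mathbb N}$-almost sure value of $\overline{\dim}_\Phi\mu_{\boldsymbol\lambda}$ for some admissible $\mathbb P$. -/

import Mathlib

open MeasureTheory Set Filter Topology
open scoped ENNReal

namespace PhiDim

/-! ### Dimension functions -/

/-- `Φ : (0,1) → [0,∞)` is a dimension function: `t ^ (1 + Φ t)` decreases to `0` as `t` decreases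
to `0`, and is doubling near `0`. Values of `Φ` outside `(0,1)` are irrelevant. -/
structure IsDimensionFunction (Φ : ℝ → ℝ) : Prop where
  nonneg : ∀ t ∈ Ioo (0 : ℝ) 1, 0 ≤ Φ t
  monotone : MonotoneOn (fun t : ℝ => t ^ (1 + Φ t)) (Ioo 0 1)
  tendsto_zero : Tendsto (fun t : ℝ => t ^ (1 + Φ t)) (𝓝[>] 0) (𝓝 0)
  doubling : ∃ T > (0 : ℝ), ∃ C > (0 : ℝ), ∀ t : ℝ, 0 < t → t < T →
    (2 * t) ^ (1 + Φ (2 * t)) ≤ C * t ^ (1 + Φ t)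

/-- A dimension function is large if, near `0`, `Φ t = H t * log |log t| / |log t|` for a function
`H` with `H t → ∞` as `t → 0`. -/
def IsLarge (Φ : ℝ → ℝ) : Prop :=
  ∃ H : ℝ → ℝ, Tendsto H (𝓝[>] 0) atTop ∧
    ∀ᶠ t in 𝓝[>] (0 : ℝ), Φ t = H t * (Real.log |Real.log t| / |Real.log t|)

/-! ### Upper and lower `Φ`-dimensions of sets and measures -/

section Dimensions

variable {X : Type*} [PseudoMetricSpace X]

/-- The least number of open balls of radius `r` required to cover `E` (`∞` if there is no finite
cover). -/
noncomputable def coveringNumber (r : ℝ) (E : Set X) : ℕ∞ :=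
  ⨅ (s : Finset X) (_ : E ⊆ ⋃ x ∈ s, Metric.ball x r), (s.card : ℕ∞)

/-- The upper `Φ`-dimension of a set. -/
noncomputable def upperDimSet (Φ : ℝ → ℝ) (E : Set X) : EReal :=
  sInf ((fun d : ℝ => (d : EReal)) '' {d : ℝ | ∃ C₁ > (0 : ℝ), ∃ C₂ > (0 : ℝ), ∀ r R : ℝ,
    0 < r → r ≤ R ^ (1 + Φ R) → R ^ (1 + Φ R) < R → R < C₁ → ∀ z ∈ E,
      (coveringNumber r (Metric.ball z R ∩ E) : ℝ≥0∞) ≤ ENNReal.ofReal (C₂ * (R / r) ^ d)})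

/-- The lower `Φ`-dimension of a set. -/
noncomputable def lowerDimSet (Φ : ℝ → ℝ) (E : Set X) : EReal :=
  sSup ((fun d : ℝ => (d : EReal)) '' {d : ℝ | ∃ C₁ > (0 : ℝ), ∃ C₂ > (0 : ℝ), ∀ r R : ℝ,
    0 < r → r ≤ R ^ (1 + Φ R) → R ^ (1 + Φ R) < R → R < C₁ → ∀ z ∈ E,
      ENNReal.ofReal (C₂ * (R / r) ^ d) ≤ (coveringNumber r (Metric.ball z R ∩ E) : ℝ≥0∞)})

variable [MeasurableSpace X]

/-- The upper `Φ`-dimension of a measure. -/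
noncomputable def upperDimMeasure (Φ : ℝ → ℝ) (μ : Measure X) : EReal :=
  sInf ((fun d : ℝ => (d : EReal)) '' {d : ℝ | ∃ C₁ > (0 : ℝ), ∃ C₂ > (0 : ℝ), ∀ r R : ℝ,
    0 < r → r < R ^ (1 + Φ R) → R ^ (1 + Φ R) ≤ R → R ≤ C₁ → ∀ x ∈ μ.support,
      μ (Metric.ball x R) / μ (Metric.ball x r) ≤ ENNReal.ofReal (C₂ * (R / r) ^ d)})

/-- The lower `Φ`-dimension of a measure. -/
noncomputable def lowerDimMeasure (Φ : ℝ → ℝ) (μ : Measure X) : EReal :=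
  sSup ((fun d : ℝ => (d : EReal)) '' {d : ℝ | ∃ C₁ > (0 : ℝ), ∃ C₂ > (0 : ℝ), ∀ r R : ℝ,
    0 < r → r < R ^ (1 + Φ R) → R ^ (1 + Φ R) ≤ R → R ≤ C₁ → ∀ x ∈ μ.support,
      ENNReal.ofReal (C₂ * (R / r) ^ d) ≤ μ (Metric.ball x R) / μ (Metric.ball x r)})

end Dimensions

/-! ### The model -/

/-- A family, indexed by `u ∈ 𝒜`, of iterated function systems of `K` similarities of `[0,1]`,
with uniform bounds on the ratios and uniform strong separation. (A similarity of `[0,1]` is the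
restriction of a unique similarity of `ℝ`.) -/
structure IFSFamily (K : ℕ) (𝒜 : Type*) [MeasurableSpace 𝒜] where
  (A B τ : ℝ)
  two_le_K : 2 ≤ K
  A_pos : 0 < A
  K_mul_A_le : K * A ≤ B
  B_lt_one : B < 1
  τ_pos : 0 < τ
  τ_le : τ ≤ (1 - B) / K
  /-- the similarity `S_i(u)` -/
  S : Fin K → 𝒜 → ℝ → ℝ
  /-- its scaling ratio `a(i,u)` -/
  a : Fin K → 𝒜 → ℝ
  measurable_a : ∀ i, Measurable (a i)
  dist_S : ∀ i u x y, dist (S i u x) (S i u y) = a i u * dist x y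
  mapsTo_S : ∀ i u, MapsTo (S i u) (Icc 0 1) (Icc 0 1)
  A_le_a : ∀ i u, A ≤ a i u
  sum_a_le : ∀ u, ∑ i, a i u ≤ B
  separated : ∀ u i j, i ≠ j → ∀ x ∈ Icc (0 : ℝ) 1, ∀ y ∈ Icc (0 : ℝ) 1,
    τ ≤ dist (S i u x) (S j u y)

/-- The space of all probability weight vectors. -/
abbrev Weights (K : ℕ) : Type := stdSimplex ℝ (Fin K)

/-- The probability measure on the index set `Fin K` given by a weight vector. -/
noncomputable def weightMeasure {K : ℕ} (p : Weights K) : Measure (Fin K) :=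
  ∑ i, ENNReal.ofReal (p.1 i) • Measure.dirac i

lemma weightMeasure_singleton {K : ℕ} (p : Weights K) (i : Fin K) :
    weightMeasure p {i} = ENNReal.ofReal (p.1 i) := by
  simp only [weightMeasure, Measure.coe_finsetSum, Finset.sum_apply, Measure.smul_apply,
    smul_eq_mul]
  rw [Finset.sum_eq_single i]
  · simp
  · intro j _ hj
    simp [hj]
  · simp

instance {K : ℕ} (p : Weights K) : IsProbabilityMeasure (weightMeasure p) := by
  constructor
  simp only [weightMeasure, Measure.coe_finsetSum, Finset.sum_apply, Measure.smul_apply,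
    smul_eq_mul, measure_univ, mul_one]
  rw [← ENNReal.ofReal_sum_of_nonneg (fun i _ => p.2.1 i), p.2.2, ENNReal.ofReal_one]

/-- `P` is an admissible law on `Λ = 𝒜 × Weights K` with marginal `Q` on `𝒜`: there is `t > 0`
with `E (p(i)^(-t)) < ∞` for all `i` (where `0 ^ (-t) = ∞`). -/
def IsAdmissible {K : ℕ} {𝒜 : Type*} [MeasurableSpace 𝒜] (Q : Measure 𝒜)
    (P : ProbabilityMeasure (𝒜 × Weights K)) : Prop :=
  (P : Measure (𝒜 × Weights K)).fst = Q ∧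
    ∃ t > (0 : ℝ), ∀ i : Fin K,
      ∫⁻ l, ENNReal.ofReal (l.2.1 i) ^ (-t) ∂(P : Measure (𝒜 × Weights K)) < ∞

namespace IFSFamily

variable {K : ℕ} {𝒜 : Type*} [MeasurableSpace 𝒜] (𝓘 : IFSFamily K 𝒜)

/-- `S_{i₁}(u₁) ∘ ⋯ ∘ S_{iₙ}(uₙ)`. -/
def compMap (u : ℕ → 𝒜) : (n : ℕ) → (Fin n → Fin K) → ℝ → ℝ
  | 0, _ => id
  | n + 1, w => compMap u n (Fin.init w) ∘ 𝓘.S (w (Fin.last n)) (u n)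

/-- The Moran interval `I_{i₁,…,iₙ}(u)` of step `n`. -/
def moranInterval (u : ℕ → 𝒜) (n : ℕ) (w : Fin n → Fin K) : Set ℝ :=
  𝓘.compMap u n w '' Icc 0 1

/-- The random Moran set. -/
def moranSet (u : ℕ → 𝒜) : Set ℝ :=
  ⋂ n : ℕ, ⋃ w : Fin n → Fin K, 𝓘.moranInterval u n w

/-- The approximations `S_{i₁}(u₁) ∘ ⋯ ∘ S_{iₙ}(uₙ) (0)` to the point with address `i₁ i₂ …`. -/
def approx (u : ℕ → 𝒜) (n : ℕ) (w : ℕ → Fin K) : ℝ :=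
  𝓘.compMap u n (fun k => w k) 0

/-- The point of the Moran set with address `i₁ i₂ …`. -/
noncomputable def point (u : ℕ → 𝒜) (w : ℕ → Fin K) : ℝ :=
  limUnder atTop (fun n => 𝓘.approx u n w)

/-- The random Moran measure of `(uₙ, pₙ)ₙ`: the law of the point with random address `i₁ i₂ …`,
where the `iₙ` are independent and `iₙ` has law `pₙ`. It is the Borel probability measure giving
each Moran interval `I_{i₁,…,iₙ}` the mass `p₁(i₁) ⋯ pₙ(iₙ)`; see `moranMeasure_moranInterval`. -/
noncomputable def moranMeasure (l : ℕ → 𝒜 × Weights K) : Measure ℝ :=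
  (Measure.infinitePi fun n => weightMeasure (l n).2).map (𝓘.point fun n => (l n).1)

/-! The defining property of the Moran measure. -/

lemma a_nonneg (i : Fin K) (v : 𝒜) : 0 ≤ 𝓘.a i v := 𝓘.A_pos.le.trans (𝓘.A_le_a i v)

lemma a_le (i : Fin K) (v : 𝒜) : 𝓘.a i v ≤ 𝓘.B :=
  (Finset.single_le_sum (fun j _ => 𝓘.a_nonneg j v) (Finset.mem_univ i)).trans (𝓘.sum_a_le v)

lemma dist_compMap (u : ℕ → 𝒜) (n : ℕ) (w : Fin n → Fin K) (x y : ℝ) :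
    dist (𝓘.compMap u n w x) (𝓘.compMap u n w y) = (∏ k, 𝓘.a (w k) (u k)) * dist x y := by
  induction n generalizing x y with
  | zero => simp [compMap]
  | succ n ih =>
    simp only [compMap, Function.comp]
    rw [ih, 𝓘.dist_S, Fin.prod_univ_castSucc]
    simp only [Fin.init, Fin.val_castSucc, Fin.val_last]
    ring

lemma prod_a_le (u : ℕ → 𝒜) (n : ℕ) (w : Fin n → Fin K) :
    ∏ k, 𝓘.a (w k) (u k) ≤ 𝓘.B ^ n :=
  (Finset.prod_le_prod (fun _ _ => 𝓘.a_nonneg _ _) (fun _ _ => 𝓘.a_le _ _)).trans_eq (by simp)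

lemma continuous_compMap (u : ℕ → 𝒜) (n : ℕ) (w : Fin n → Fin K) :
    Continuous (𝓘.compMap u n w) :=
  (LipschitzWith.of_dist_le_mul (K := Real.toNNReal (∏ k, 𝓘.a (w k) (u k))) fun x y => by
    rw [𝓘.dist_compMap, Real.coe_toNNReal _ (Finset.prod_nonneg fun _ _ => 𝓘.a_nonneg _ _)]).continuous

lemma isCompact_moranInterval (u : ℕ → 𝒜) (n : ℕ) (w : Fin n → Fin K) :
    IsCompact (𝓘.moranInterval u n w) :=
  isCompact_Icc.image (𝓘.continuous_compMap u n w)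

lemma moranInterval_succ_subset (u : ℕ → 𝒜) (n : ℕ) (w : Fin (n + 1) → Fin K) :
    𝓘.moranInterval u (n + 1) w ⊆ 𝓘.moranInterval u n (Fin.init w) := by
  rintro _ ⟨x, hx, rfl⟩
  exact ⟨_, 𝓘.mapsTo_S _ _ hx, rfl⟩

lemma eq_of_mem_moranInterval (u : ℕ → 𝒜) (n : ℕ) (v w : Fin n → Fin K) (x : ℝ)
    (hv : x ∈ 𝓘.moranInterval u n v) (hw : x ∈ 𝓘.moranInterval u n w) : v = w := by
  induction n with
  | zero => exact Subsingleton.elim _ _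
  | succ n ih =>
    have h := ih _ _ (𝓘.moranInterval_succ_subset u n v hv) (𝓘.moranInterval_succ_subset u n w hw)
    obtain ⟨y, hy, hyx⟩ := hv
    obtain ⟨z, hz, hzx⟩ := hw
    have hl : v (Fin.last n) = w (Fin.last n) := by
      by_contra hne
      have h1 := 𝓘.separated (u n) _ _ hne y hy z hz
      have h2 := 𝓘.dist_compMap u n (Fin.init v) (𝓘.S (v (Fin.last n)) (u n) y)
        (𝓘.S (w (Fin.last n)) (u n) z)
      have h3 : 𝓘.compMap u n (Fin.init v) (𝓘.S (v (Fin.last n)) (u n) y)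
          = 𝓘.compMap u n (Fin.init v) (𝓘.S (w (Fin.last n)) (u n) z) := by
        conv_rhs => rw [h]
        exact hyx.trans hzx.symm
      rw [h3, dist_self] at h2
      have h4 : 0 < ∏ k : Fin n, 𝓘.a (Fin.init v k) (u k) :=
        Finset.prod_pos fun _ _ => 𝓘.A_pos.trans_le (𝓘.A_le_a _ _)
      have h5 := mul_pos h4 (𝓘.τ_pos.trans_le h1)
      linarith
    rw [← Fin.snoc_init_self v, ← Fin.snoc_init_self w, h, hl]

lemma approx_mem (u : ℕ → 𝒜) (w : ℕ → Fin K) (n k : ℕ) :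
    𝓘.approx u (n + k) w ∈ 𝓘.moranInterval u n (fun j => w j) := by
  have h : ∀ k, 𝓘.moranInterval u (n + k) (fun j => w j) ⊆ 𝓘.moranInterval u n (fun j => w j) := by
    intro k
    induction k with
    | zero => exact subset_rfl
    | succ k ih => exact (𝓘.moranInterval_succ_subset u (n + k) _).trans ih
  exact h k ⟨0, by simp, rfl⟩

lemma tendsto_approx (u : ℕ → 𝒜) (w : ℕ → Fin K) :
    Tendsto (fun n => 𝓘.approx u n w) atTop (𝓝 (𝓘.point u w)) := by
  have hc : CauchySeq (fun n => 𝓘.approx u n w) := by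
    refine cauchySeq_of_le_geometric 𝓘.B 1 𝓘.B_lt_one fun n => ?_
    have h1 : 𝓘.approx u (n + 1) w
        = 𝓘.compMap u n (fun k => w k) (𝓘.S (w n) (u n) 0) := rfl
    have h2 := 𝓘.mapsTo_S (w n) (u n) (show (0 : ℝ) ∈ Icc (0 : ℝ) 1 by simp)
    have h3 : dist (0 : ℝ) (𝓘.S (w n) (u n) 0) ≤ 1 := by
      rw [Real.dist_eq, abs_le]
      constructor <;> linarith [h2.1, h2.2]
    have h4 := 𝓘.prod_a_le u n (fun k => w k)
    have h5 : 0 ≤ ∏ k : Fin n, 𝓘.a (w k) (u k) := Finset.prod_nonneg fun _ _ => 𝓘.a_nonneg _ _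
    rw [h1, approx, 𝓘.dist_compMap]
    nlinarith
  exact hc.tendsto_limUnder

lemma point_mem (u : ℕ → 𝒜) (w : ℕ → Fin K) (n : ℕ) :
    𝓘.point u w ∈ 𝓘.moranInterval u n (fun j => w j) := by
  refine (𝓘.isCompact_moranInterval u n _).isClosed.mem_of_tendsto (𝓘.tendsto_approx u w) ?_
  filter_upwards [eventually_ge_atTop n] with m hm
  obtain ⟨k, rfl⟩ := Nat.exists_eq_add_of_le hm
  exact 𝓘.approx_mem u w n k

lemma measurable_point (u : ℕ → 𝒜) : Measurable (𝓘.point u) := by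
  refine measurable_of_tendsto_metrizable (f := fun n w => 𝓘.approx u n w) (fun n => ?_)
    (tendsto_pi_nhds.2 fun w => 𝓘.tendsto_approx u w)
  have h : Measurable (fun v : Fin n → Fin K => 𝓘.compMap u n v 0) := measurable_of_finite _
  exact h.comp (measurable_pi_lambda _ fun k => measurable_pi_apply _)

instance (l : ℕ → 𝒜 × Weights K) : IsProbabilityMeasure (𝓘.moranMeasure l) :=
  Measure.isProbabilityMeasure_map (𝓘.measurable_point _).aemeasurable

theorem moranMeasure_moranInterval (l : ℕ → 𝒜 × Weights K) (n : ℕ) (w : Fin n → Fin K) :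
    𝓘.moranMeasure l (𝓘.moranInterval (fun m => (l m).1) n w)
      = ∏ k : Fin n, ENNReal.ofReal ((l k).2.1 (w k)) := by
  classical
  rw [moranMeasure, Measure.map_apply (𝓘.measurable_point _)
    (𝓘.isCompact_moranInterval _ n w).isClosed.measurableSet]
  let t : ℕ → Set (Fin K) := fun m => if h : m < n then {w ⟨m, h⟩} else univ
  have h : 𝓘.point (fun m => (l m).1) ⁻¹' 𝓘.moranInterval (fun m => (l m).1) n w
      = Set.pi (Finset.range n : Set ℕ) t := by
    ext v
    simp only [mem_preimage, Set.mem_pi, Finset.coe_range, mem_Iio]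
    constructor
    · intro hv m hm
      have := 𝓘.eq_of_mem_moranInterval _ n _ _ _ (𝓘.point_mem _ v n) hv
      simp only [t, hm, dif_pos, mem_singleton_iff]
      exact congrFun this ⟨m, hm⟩
    · intro hv
      have : w = fun j : Fin n => v j := by
        funext j
        have := hv j j.2
        simp only [t, j.2, dif_pos, mem_singleton_iff] at this
        exact this.symm
      rw [this]
      exact 𝓘.point_mem _ v n
  rw [h, Measure.infinitePi_pi _ (fun _ _ => MeasurableSet.of_discrete), Finset.prod_range]
  refine Finset.prod_congr rfl fun k _ => ?_
  simp [t, weightMeasure_singleton]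

end IFSFamily

end PhiDim

/-!
Let `D` be the zero of the mean pressure `x ↦ E log ∑ᵢ a(i)^x`, which is continuous and strictly
decreasing. The random Moran set carries a natural measure, with the weights
`p(i) = a(i)^D / ∑ⱼ a(j)^D`. The mass of a Moran interval is its length to the power `D`, divided by
the exponential of the sum of the pressures `log ∑ᵢ a(i,uₖ)^D` met so far. These pressures are
independent, bounded and centred, so Hoeffding's inequality and the Borel–Cantelli lemma control
all their block sums at once (`ae_forall_exists_abs_sum_le`): almost surely, for every `ε > 0` there
is `M` such that the block of length `n` after the time `N` has absolute value at most
`ε n + M log (N + 2)`.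

By uniform strong separation, balls centred in the Moran set are comparable with Moran intervals,
and a ball of radius `R` corresponds to a step `N` of order at most `|log R|`. Hence almost surely
`ν (B(x,R)) / ν (B(x,r))` equals `(R / r) ^ D` up to `(R / r) ^ (± ε)` and a power of `|log R|`
(`IsLogRegular`, `HasLogFluctuations.isLogRegular_naturalMeasure`). A large dimension function only
looks at radii with `R / r ≥ |log R| ^ H(R)`, where `H(R) → ∞`, and there the power of `|log R|` is
absorbed by `(R / r) ^ ε` (`IsLarge.exists_log_rpow_le`).

The rest is deterministic. Log-regularity of `ν` gives the `Φ`-dimensions of `ν` directly, those of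
its support by comparing covering numbers with masses of balls, and the Hausdorff dimension by the
mass distribution principle. Finally, an admissible law has positive weights almost surely, so each
associated measure `μ` is supported on the whole Moran set. Fixing `R` and letting `r → 0`, an
exponent `d` allowed in the definition of a `Φ`-dimension of `μ` bounds the mass of small balls of
`μ` by a multiple of `r ^ d` on one side, and counting balls compares `d` with the box dimension
`D` of the support (`exponent_le_of_ball_bounds`).
-/

/-! ### Covering numbers, masses of balls, and large dimension functions -/

namespace PhiDim

section Covering

variable {X : Type*} [PseudoMetricSpace X]

lemma exists_finset_card_eq_coveringNumber {E : Set X} (hE : TotallyBounded E) {r : ℝ}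
    (hr : 0 < r) : ∃ s : Finset X, E ⊆ ⋃ x ∈ s, Metric.ball x r ∧
      coveringNumber r E = (s.card : ℕ∞) := by
  obtain ⟨t, ht, hEt⟩ := Metric.totallyBounded_iff.1 hE r hr
  have hne : {s : Finset X | E ⊆ ⋃ x ∈ s, Metric.ball x r}.Nonempty :=
    ⟨ht.toFinset, by simpa using hEt⟩
  obtain ⟨s, hs, hmin⟩ := exists_minimalFor_of_wellFoundedLT
    (fun s : Finset X => E ⊆ ⋃ x ∈ s, Metric.ball x r) Finset.card hne
  refine ⟨s, hs, le_antisymm (iInf₂_le s hs) (le_iInf₂ fun s' hs' => ?_)⟩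
  rcases le_total s.card s'.card with h | h
  · exact_mod_cast h
  · exact_mod_cast hmin hs' h

lemma exists_nat_eq_coveringNumber {E : Set X} (hE : TotallyBounded E) {r : ℝ} (hr : 0 < r) :
    ∃ n : ℕ, coveringNumber r E = n :=
  let ⟨s, _, hs⟩ := exists_finset_card_eq_coveringNumber hE hr
  ⟨s.card, hs⟩

/-- A maximal `r`-separated subset of a totally bounded set is finite and `r`-dense. -/
lemma exists_finset_separated_cover {E : Set X} (hE : TotallyBounded E) {r : ℝ} (hr : 0 < r) :
    ∃ s : Finset X, (s : Set X) ⊆ E ∧ (∀ x ∈ s, ∀ y ∈ s, x ≠ y → r ≤ dist x y) ∧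
      E ⊆ ⋃ x ∈ s, Metric.ball x r := by
  classical
  obtain ⟨t, htf, ht⟩ := Metric.totallyBounded_iff.1 hE (r / 2) (half_pos hr)
  let Sep : Finset X → Prop := fun s =>
    (s : Set X) ⊆ E ∧ ∀ x ∈ s, ∀ y ∈ s, x ≠ y → r ≤ dist x y
  -- each ball of radius `r / 2` contains at most one point of a separated set
  have hcard : ∀ s, Sep s → s.card ≤ htf.toFinset.card := by
    intro s hs
    have hex : ∀ x ∈ s, ∃ y ∈ htf.toFinset, dist x y < r / 2 := by
      intro x hx
      have := ht (hs.1 hx)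
      simpa using this
    choose! f hf hfd using hex
    refine Finset.card_le_card_of_injOn f hf fun x hx y hy hxy => ?_
    by_contra hne
    have h1 := hs.2 x hx y hy hne
    have h2 := hfd x hx
    have h3 := hfd y hy
    rw [← hxy] at h3
    linarith [dist_triangle_right x y (f x)]
  have hfin : {n | ∃ s, Sep s ∧ s.card = n}.Finite :=
    (Set.finite_Iic htf.toFinset.card).subset (by rintro _ ⟨s, hs, rfl⟩; exact hcard s hs)
  obtain ⟨n, ⟨⟨s, hs, rfl⟩, hmax⟩⟩ := hfin.exists_maximal ⟨0, ∅, by simp [Sep], rfl⟩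
  refine ⟨s, hs.1, hs.2, fun x hx => ?_⟩
  by_contra hxs
  simp only [mem_iUnion, Metric.mem_ball, not_exists, not_lt] at hxs
  have hxs' : x ∉ s := fun h => by
    have := hxs x h
    rw [dist_self] at this
    linarith
  have hins : Sep (insert x s) := by
    refine ⟨by simpa [insert_subset_iff] using ⟨hx, hs.1⟩, fun y hy z hz hyz => ?_⟩
    rcases Finset.mem_insert.1 hy with rfl | hys <;> rcases Finset.mem_insert.1 hz with rfl | hzs
    · exact absurd rfl hyz
    · exact hxs z hzs
    · rw [dist_comm]; exact hxs y hys
    · exact hs.2 y hys z hzs hyz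
  have := hmax ⟨_, hins, rfl⟩ (by rw [Finset.card_insert_of_notMem hxs']; omega)
  rw [Finset.card_insert_of_notMem hxs'] at this
  omega

variable [MeasurableSpace X] {μ : Measure X} [IsFiniteMeasure μ]

/-- Mass bounds covering numbers from below: a covering ball that meets `E` lies in a ball of twice
the radius centred in `E`. -/
lemma measureReal_le_coveringNumber_mul {E : Set X} (hE : TotallyBounded E) {r b : ℝ} (hr : 0 < r)
    (hb0 : 0 ≤ b) {n : ℕ} (hn : coveringNumber r E = n)
    (hb : ∀ x ∈ E, μ.real (Metric.ball x (2 * r)) ≤ b) : μ.real E ≤ n * b := by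
  obtain ⟨s, hs, hcard⟩ := exists_finset_card_eq_coveringNumber hE hr
  rw [hn] at hcard
  have hcard' : n = s.card := by exact_mod_cast hcard
  have h1 : μ.real E ≤ μ.real (⋃ y ∈ s, Metric.ball y r ∩ E) := by
    refine measureReal_mono (fun x hx => ?_) (measure_ne_top _ _)
    obtain ⟨y, hy, hxy⟩ := mem_iUnion₂.1 (hs hx)
    exact mem_iUnion₂.2 ⟨y, hy, hxy, hx⟩
  refine (h1.trans (measureReal_biUnion_finset_le _ _)).trans ?_
  rw [hcard', ← nsmul_eq_mul]
  refine Finset.sum_le_card_nsmul _ _ _ fun y _ => ?_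
  rcases (Metric.ball y r ∩ E).eq_empty_or_nonempty with he | ⟨x, hx, hxE⟩
  · rw [he]; simpa using hb0
  · refine (measureReal_mono (inter_subset_left.trans ?_)).trans (hb x hxE)
    exact Metric.ball_subset_ball' (by rw [dist_comm]; linarith [Metric.mem_ball.1 hx])

/-- Mass bounds covering numbers from above: the balls of radius `r / 2` around an `r`-separated set
are disjoint. -/
lemma coveringNumber_mul_le_measureReal [OpensMeasurableSpace X] {E U : Set X}
    (hE : TotallyBounded E) {r c : ℝ} (hr : 0 < r) (hc0 : 0 ≤ c) {n : ℕ}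
    (hn : coveringNumber r E = n) (hc : ∀ x ∈ E, c ≤ μ.real (Metric.ball x (r / 2)))
    (hU : ∀ x ∈ E, Metric.ball x (r / 2) ⊆ U) : n * c ≤ μ.real U := by
  obtain ⟨s, hsE, hsep, hs⟩ := exists_finset_separated_cover hE hr
  have hns : n ≤ s.card := by
    have : coveringNumber r E ≤ s.card := iInf₂_le s hs
    rw [hn] at this
    exact_mod_cast this
  have hdisj : (s : Set X).PairwiseDisjoint fun x => Metric.ball x (r / 2) := fun x hx y hy hxy =>
    Metric.ball_disjoint_ball (by linarith [hsep x hx y hy hxy])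
  calc n * c ≤ s.card * c := by gcongr
    _ = ∑ _x ∈ s, c := by simp
    _ ≤ ∑ x ∈ s, μ.real (Metric.ball x (r / 2)) := Finset.sum_le_sum fun x hx => hc x (hsE hx)
    _ = μ.real (⋃ x ∈ s, Metric.ball x (r / 2)) :=
        (measureReal_biUnion_finset hdisj fun x _ => Metric.isOpen_ball.measurableSet).symm
    _ ≤ μ.real U := measureReal_mono (iUnion₂_subset fun x hx => hU x (hsE hx))

/-- On a compact subset of the support, balls of a fixed radius have mass bounded below. -/
lemma exists_pos_forall_le_measureReal_ball {F : Set X} (hF : IsCompact F) (hFs : F ⊆ μ.support)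
    {R : ℝ} (hR : 0 < R) : ∃ c > 0, ∀ x ∈ F, c ≤ μ.real (Metric.ball x R) := by
  have hpos : ∀ x ∈ F, 0 < μ.real (Metric.ball x (R / 2)) := fun x hx =>
    ENNReal.toReal_pos ((Measure.mem_support_iff_forall x).1 (hFs hx) _
      (Metric.ball_mem_nhds x (half_pos hR))).ne' (measure_ne_top _ _)
  obtain ⟨t, htF, htf, ht⟩ := hF.finite_cover_balls (half_pos hR)
  rcases t.eq_empty_or_nonempty with rfl | hne
  · refine ⟨1, one_pos, fun x hx => ?_⟩
    simpa using ht hx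
  obtain ⟨y, hy, hmin⟩ := htf.exists_minimalFor (fun x => μ.real (Metric.ball x (R / 2))) t hne
  refine ⟨_, hpos y (htF hy), fun x hx => ?_⟩
  obtain ⟨z, hz, hxz⟩ := mem_iUnion₂.1 (ht hx)
  have h1 : μ.real (Metric.ball y (R / 2)) ≤ μ.real (Metric.ball z (R / 2)) := by
    rcases le_total (μ.real (Metric.ball y (R / 2))) (μ.real (Metric.ball z (R / 2))) with h | h
    · exact h
    · exact hmin hz h
  refine h1.trans (measureReal_mono (Metric.ball_subset_ball' ?_))
  rw [dist_comm]
  linarith [Metric.mem_ball.1 hxz]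

end Covering

/-- Below the scale `R ^ (1 + Φ R)` of a large dimension function, every power of `|log R|` is
negligible against every power of `R / r`. -/
lemma IsLarge.exists_log_rpow_le {Φ : ℝ → ℝ} (hΦ : IsLarge Φ) {M ε : ℝ} (hM : 0 ≤ M)
    (hε : 0 < ε) : ∃ δ > 0, δ ≤ 1 ∧ ∀ R, 0 < R → R < δ → R ^ (1 + Φ R) < R ∧
      ∀ r, 0 < r → r ≤ R ^ (1 + Φ R) → 2 * r ≤ R ∧ (1 + |Real.log R|) ^ M ≤ (R / r) ^ ε := by
  obtain ⟨H, hH, hΦH⟩ := hΦ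
  have h1 : ∀ᶠ t in 𝓝[>] (0 : ℝ), max (2 * (M / ε)) 1 ≤ H t := hH.eventually_ge_atTop _
  have h2 : ∀ᶠ t in 𝓝[>] (0 : ℝ), t < Real.exp (-2) :=
    nhdsWithin_le_nhds (Iio_mem_nhds (Real.exp_pos _))
  obtain ⟨δ, hδ, h⟩ := mem_nhdsGT_iff_exists_Ioo_subset.1 ((hΦH.and h1).and h2)
  refine ⟨min δ 1, lt_min hδ one_pos, min_le_right _ _, fun R hR hRδ => ?_⟩
  obtain ⟨⟨hΦR, hHR⟩, hR2⟩ := h ⟨hR, hRδ.trans_le (min_le_left _ _)⟩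
  have hlog : Real.log R < -2 := by
    rw [← Real.log_exp (-2)]
    exact Real.log_lt_log hR hR2
  set l := |Real.log R| with hl
  have hlR : l = -Real.log R := abs_of_neg (by linarith)
  have hl2 : 2 < l := by linarith
  have hl0 : 0 < l := by linarith
  have hll : 0 < Real.log l := Real.log_pos (by linarith)
  -- `Φ R * log R = -H R * log |log R|`, so `R ^ Φ R = |log R| ^ (-H R)`
  have hscale : R ^ (1 + Φ R) = R * (l ^ (H R))⁻¹ := by
    rw [Real.rpow_add hR, Real.rpow_one, Real.rpow_def_of_pos hR, Real.rpow_def_of_pos hl0,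
      ← Real.exp_neg, hΦR]
    congr 2
    have : Real.log R = -l := by linarith
    rw [this]
    field_simp
  have hH1 : l ≤ l ^ (H R) := by
    conv_lhs => rw [← Real.rpow_one l]
    exact Real.rpow_le_rpow_of_exponent_le (by linarith) ((le_max_right _ _).trans hHR)
  have hHM : l ^ (2 * (M / ε)) ≤ l ^ (H R) :=
    Real.rpow_le_rpow_of_exponent_le (by linarith) ((le_max_left _ _).trans hHR)
  have hlH : 0 < l ^ (H R) := by positivity
  refine ⟨?_, fun r hr hrR => ?_⟩
  · rw [hscale, ← div_eq_mul_inv, div_lt_iff₀ hlH]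
    nlinarith
  have hratio : l ^ (H R) ≤ R / r := by
    rw [hscale, ← div_eq_mul_inv, le_div_iff₀ hlH] at hrR
    rw [le_div_iff₀ hr]
    linarith
  refine ⟨?_, ?_⟩
  · have : 2 ≤ R / r := by linarith
    rwa [le_div_iff₀ hr] at this
  calc (1 + l) ^ M ≤ (l ^ (2 : ℝ)) ^ M := by
        refine Real.rpow_le_rpow (by linarith) ?_ hM
        rw [Real.rpow_two]
        nlinarith
    -- the exponent that `H R` has been made to exceed
    _ = (l ^ (2 * (M / ε))) ^ ε := by
        rw [← Real.rpow_mul hl0.le, ← Real.rpow_mul hl0.le]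
        congr 1
        field_simp
    _ ≤ (R / r) ^ ε := Real.rpow_le_rpow (by positivity) (hHM.trans hratio) hε.le

/-- Exponents can be compared through the growth of powers. -/
lemma le_of_forall_mul_rpow_le {a b c C T : ℝ} (hc : 0 < c)
    (h : ∀ t ≥ T, 0 < t → c * t ^ a ≤ C * t ^ b) : a ≤ b := by
  by_contra! hab
  have h1 : Tendsto (fun t : ℝ => c * t ^ (a - b)) atTop atTop :=
    (tendsto_rpow_atTop (sub_pos.2 hab)).const_mul_atTop hc
  obtain ⟨t, ⟨ht1, ht2⟩, ht3⟩ :=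
    ((h1.eventually_gt_atTop C).and (eventually_ge_atTop T)).and (eventually_gt_atTop 0) |>.exists
  have h2 := h t ht2 ht3
  rw [Real.rpow_sub ht3, ← mul_div_assoc, lt_div_iff₀ (by positivity)] at ht1
  linarith

lemma sInf_image_coe_eq {V : Set ℝ} {D : ℝ} (h₁ : ∀ ε > 0, D + ε ∈ V) (h₂ : ∀ d ∈ V, D ≤ d) :
    sInf ((fun d : ℝ => (d : EReal)) '' V) = D := by
  refine le_antisymm ?_ (le_sInf ?_)
  · refine EReal.le_of_forall_lt_iff_le.1 fun z hz => sInf_le ⟨z, ?_, rfl⟩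
    have := h₁ (z - D) (sub_pos.2 (EReal.coe_lt_coe_iff.1 hz))
    rwa [add_sub_cancel] at this
  · rintro _ ⟨d, hd, rfl⟩
    exact EReal.coe_le_coe_iff.2 (h₂ d hd)

lemma sSup_image_coe_eq {V : Set ℝ} {D : ℝ} (h₁ : ∀ ε > 0, D - ε ∈ V) (h₂ : ∀ d ∈ V, d ≤ D) :
    sSup ((fun d : ℝ => (d : EReal)) '' V) = D := by
  refine le_antisymm (sSup_le ?_) ?_
  · rintro _ ⟨d, hd, rfl⟩
    exact EReal.coe_le_coe_iff.2 (h₂ d hd)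
  · refine EReal.ge_of_forall_gt_iff_ge.1 fun z hz => le_sSup ⟨z, ?_, rfl⟩
    have := h₁ (D - z) (sub_pos.2 (EReal.coe_lt_coe_iff.1 hz))
    rwa [sub_sub_cancel] at this

end PhiDim

/-! ### Log-regular measures -/

namespace PhiDim

section LogRegular

variable {X : Type*} [MetricSpace X] [MeasurableSpace X]

/-- A measure is log-regular of dimension `D` if, up to an arbitrarily small error in the exponent
and a power of `|log R|`, the mass of concentric balls centred in the support and of radii `r ≤ R`
changes by the factor `(R / r) ^ D`. -/
def IsLogRegular (ν : Measure X) (D : ℝ) : Prop :=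
  ∀ ε > (0 : ℝ), ∃ M ≥ (0 : ℝ), ∃ C > (0 : ℝ), ∃ δ > (0 : ℝ), δ ≤ 1 ∧
    ∀ x ∈ ν.support, ∀ r R, 0 < r → r ≤ R → R < δ →
      ν.real (Metric.ball x R)
        ≤ C * (1 + |Real.log R|) ^ M * (R / r) ^ (D + ε) * ν.real (Metric.ball x r) ∧
      (R / r) ^ (D - ε) * ν.real (Metric.ball x r)
        ≤ C * (1 + |Real.log R|) ^ M * ν.real (Metric.ball x R)

lemma measureReal_ball_pos {ν : Measure X} [IsFiniteMeasure ν] {x : X} (hx : x ∈ ν.support)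
    {r : ℝ} (hr : 0 < r) : 0 < ν.real (Metric.ball x r) :=
  ENNReal.toReal_pos ((Measure.mem_support_iff_forall x).1 hx _ (Metric.ball_mem_nhds x hr)).ne'
    (measure_ne_top _ _)

lemma measure_ball_div {ν : Measure X} [IsFiniteMeasure ν] {x : X} (hx : x ∈ ν.support)
    {r R : ℝ} (hr : 0 < r) : ν (Metric.ball x R) / ν (Metric.ball x r)
      = ENNReal.ofReal (ν.real (Metric.ball x R) / ν.real (Metric.ball x r)) := by
  rw [ENNReal.ofReal_div_of_pos (measureReal_ball_pos hx hr), ofReal_measureReal,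
    ofReal_measureReal]

lemma rpow_div_eq {R r d : ℝ} (hR : 0 < R) (hr : 0 < r) : (R / r) ^ d = R ^ d / r ^ d :=
  Real.div_rpow hR.le hr.le d

variable {ν μ : Measure X} [IsProbabilityMeasure ν] [IsProbabilityMeasure μ]

/-- Power bounds for the balls of two probability measures with the same support are compared by
counting the balls needed to cover the support. -/
lemma exponent_le_of_ball_bounds [BorelSpace X] [SecondCountableTopology X]
    (hν : IsCompact ν.support) {s t c C δ : ℝ}
    (hc : 0 < c) (hC : 0 < C) (hδ : 0 < δ)
    (hμ : ∀ x ∈ ν.support, ∀ r, 0 < r → r < δ → c * r ^ s ≤ μ.real (Metric.ball x r))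
    (hν' : ∀ x ∈ ν.support, ∀ r, 0 < r → r < δ → ν.real (Metric.ball x r) ≤ C * r ^ t) :
    t ≤ s := by
  have hE := hν.totallyBounded
  have key : ∀ r, 0 < r → r < δ / 2 → c * (r / 2) ^ s ≤ C * (2 * r) ^ t := by
    intro r hr hrδ
    obtain ⟨S, -, hn⟩ := exists_finset_card_eq_coveringNumber hE hr
    have h1 := coveringNumber_mul_le_measureReal (μ := μ) (U := univ) hE hr
      (c := c * (r / 2) ^ s) (by positivity) hn
      (fun x hx => hμ x hx _ (by linarith) (by linarith)) fun _ _ => subset_univ _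
    have h2 := measureReal_le_coveringNumber_mul (μ := ν) hE hr
      (b := C * (2 * r) ^ t) (by positivity) hn
      (fun x hx => hν' x hx _ (by linarith) (by linarith))
    have h3 : ν.real ν.support = 1 := by
      rw [measureReal_def, prob_compl_eq_zero_iff₀ Measure.nullMeasurableSet_support |>.1
        Measure.measure_compl_support]
      simp
    rw [h3] at h2
    rw [probReal_univ] at h1
    have hS : (0 : ℝ) < S.card := by
      rcases (Nat.cast_nonneg (α := ℝ) S.card).eq_or_lt with h | h
      · rw [← h] at h2; linarith
      · exact h
    exact le_of_mul_le_mul_left (h1.trans h2) hS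
  -- compare the two sides as powers of `1 / r`
  have h := le_of_forall_mul_rpow_le (a := -s) (b := -t) (c := c * (1 / 2) ^ s) (C := C * 2 ^ t)
    (T := 2 / δ + 1) (by positivity) fun x hx hx0 => by
      have h1 := key x⁻¹ (by positivity) (by
        have : 2 / δ < x := by linarith
        rw [inv_lt_comm₀ hx0 (by positivity)]
        rwa [inv_div])
      rw [div_eq_mul_inv, mul_comm x⁻¹, Real.mul_rpow (by norm_num) (by positivity),
        Real.mul_rpow (by norm_num) (by positivity), Real.inv_rpow hx0.le, Real.inv_rpow hx0.le,
        ← Real.rpow_neg hx0.le, ← Real.rpow_neg hx0.le, ← mul_assoc, ← mul_assoc] at h1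
      simpa using h1
  linarith

/-- A lower power bound for small balls follows from their comparison with balls of a fixed radius,
whose masses are bounded below by compactness of the support. -/
lemma ball_lower_bound_of_ratio (hμ : IsCompact μ.support) {R₀ δ K d : ℝ} (hR : 0 < R₀)
    (hK : 0 < K) (h : ∀ x ∈ μ.support, ∀ r, 0 < r → r < δ →
      μ.real (Metric.ball x R₀) ≤ K * (R₀ / r) ^ d * μ.real (Metric.ball x r)) :
    ∃ c > 0, ∀ x ∈ μ.support, ∀ r, 0 < r → r < δ → c * r ^ d ≤ μ.real (Metric.ball x r) := by
  obtain ⟨c, hc, hcb⟩ := exists_pos_forall_le_measureReal_ball hμ subset_rfl hR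
  refine ⟨c / (K * R₀ ^ d), by positivity, fun x hx r hr hrδ => ?_⟩
  have h1 := (hcb x hx).trans (h x hx r hr hrδ)
  rw [rpow_div_eq hR hr] at h1
  have : 0 < r ^ d := by positivity
  have : 0 < R₀ ^ d := by positivity
  rw [div_mul_eq_mul_div, div_le_iff₀ (by positivity)]
  calc c * r ^ d ≤ K * (R₀ ^ d / r ^ d) * μ.real (Metric.ball x r) * r ^ d := by gcongr
    _ = _ := by field_simp

lemma ball_upper_bound_of_ratio {R₀ δ K d : ℝ} (hR : 0 < R₀)
    (hK : 0 < K) (h : ∀ x ∈ μ.support, ∀ r, 0 < r → r < δ →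
      K * (R₀ / r) ^ d * μ.real (Metric.ball x r) ≤ μ.real (Metric.ball x R₀)) :
    ∃ C > 0, ∀ x ∈ μ.support, ∀ r, 0 < r → r < δ → μ.real (Metric.ball x r) ≤ C * r ^ d := by
  refine ⟨1 / (K * R₀ ^ d), by positivity, fun x hx r hr hrδ => ?_⟩
  have h1 := (h x hx r hr hrδ).trans measureReal_le_one
  rw [rpow_div_eq hR hr] at h1
  have : 0 < r ^ d := by positivity
  have : 0 < R₀ ^ d := by positivity
  rw [div_mul_eq_mul_div, le_div_iff₀ (by positivity), one_mul]
  calc μ.real (Metric.ball x r) * (K * R₀ ^ d)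
      = K * (R₀ ^ d / r ^ d) * μ.real (Metric.ball x r) * r ^ d := by field_simp
    _ ≤ 1 * r ^ d := by gcongr
    _ = r ^ d := one_mul _

namespace IsLogRegular

variable {D : ℝ}

/-- Fixing the larger radius in the definition makes the power of `|log R|` a constant. -/
lemma exists_ball_bounds (h : IsLogRegular ν D) (hν : IsCompact ν.support) {ε : ℝ} (hε : 0 < ε) :
    ∃ c > 0, ∃ C > 0, ∃ δ > 0, ∀ x ∈ ν.support, ∀ r, 0 < r → r < δ →
      c * r ^ (D + ε) ≤ ν.real (Metric.ball x r) ∧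
      ν.real (Metric.ball x r) ≤ C * r ^ (D - ε) := by
  obtain ⟨M, hM, K, hK, δ, hδ, hδ1, hb⟩ := h ε hε
  have hL : 0 < K * (1 + |Real.log (δ / 2)|) ^ M := by positivity
  obtain ⟨c, hc, h1⟩ := ball_lower_bound_of_ratio hν (δ := δ / 2) (half_pos hδ) hL
    fun x hx r hr hrδ => (hb x hx r (δ / 2) hr hrδ.le (half_lt_self hδ)).1
  obtain ⟨C, hC, h2⟩ := ball_upper_bound_of_ratio (μ := ν) (δ := δ / 2) (d := D - ε) (half_pos hδ)
    (inv_pos.2 hL) fun x hx r hr hrδ => by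
      rw [mul_assoc, inv_mul_le_iff₀ hL]
      exact (hb x hx r (δ / 2) hr hrδ.le (half_lt_self hδ)).2
  exact ⟨c, hc, C, hC, δ / 2, half_pos hδ,
    fun x hx r hr hrδ => ⟨h1 x hx r hr hrδ, h2 x hx r hr hrδ⟩⟩

/-- Below the scale of a large dimension function, the power of `|log R|` in log-regularity is
absorbed by half of the error in the exponent. -/
lemma exists_ratio_bounds {ν : Measure X} (h : IsLogRegular ν D) {Φ : ℝ → ℝ} (hΦ : IsLarge Φ)
    {ε : ℝ} (hε : 0 < ε) : ∃ C > 0, ∃ δ > 0, ∀ x ∈ ν.support, ∀ r R, 0 < r →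
      r ≤ R ^ (1 + Φ R) → r ≤ R → R < δ →
      ν.real (Metric.ball x R) ≤ C * (R / r) ^ (D + ε) * ν.real (Metric.ball x r) ∧
        (R / r) ^ (D - ε) * ν.real (Metric.ball x r) ≤ C * ν.real (Metric.ball x R) := by
  obtain ⟨M, hM, C, hC, δ, hδ, hδ1, hb⟩ := h (ε / 2) (half_pos hε)
  obtain ⟨δ', hδ', -, hδR⟩ := hΦ.exists_log_rpow_le (M := M) hM (half_pos hε)
  refine ⟨C, hC, min δ δ', lt_min hδ hδ', fun x hx r R hr hrΦ hrR hRδ => ?_⟩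
  have hR : 0 < R := hr.trans_le hrR
  have hlog := ((hδR R hR (hRδ.trans_le (min_le_right _ _))).2 r hr hrΦ).2
  obtain ⟨h1, h2⟩ := hb x hx r R hr hrR (hRδ.trans_le (min_le_left _ _))
  have hRr : 0 < R / r := div_pos hR hr
  have hm := measureReal_nonneg (μ := ν) (s := Metric.ball x r)
  constructor
  · have e : D + ε = ε / 2 + (D + ε / 2) := by ring
    rw [e, Real.rpow_add hRr, ← mul_assoc]
    exact h1.trans (by gcongr)
  · have e : D - ε / 2 = ε / 2 + (D - ε) := by ring
    rw [e, Real.rpow_add hRr] at h2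
    have h3 : (R / r) ^ (ε / 2) * (R / r) ^ (D - ε) * ν.real (Metric.ball x r)
        ≤ C * (R / r) ^ (ε / 2) * ν.real (Metric.ball x R) := h2.trans (by gcongr)
    have h4 : 0 < (R / r) ^ (ε / 2) := by positivity
    refine le_of_mul_le_mul_left ?_ h4
    linarith

variable [BorelSpace X] [SecondCountableTopology X]

/-- Any probability measure with the support of `ν` distributes its mass over a set of box
dimension `D`, so its upper dimension cannot be smaller. -/
theorem le_upperDimMeasure (h : IsLogRegular ν D) (hν : IsCompact ν.support)
    (hμν : μ.support = ν.support) {Φ : ℝ → ℝ} (hΦ : IsLarge Φ) :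
    (D : EReal) ≤ upperDimMeasure Φ μ := by
  refine le_sInf ?_
  rintro _ ⟨d, ⟨C₁, hC₁, C₂, hC₂, hd⟩, rfl⟩
  refine EReal.coe_le_coe_iff.2 (le_of_forall_pos_le_add fun ε hε => ?_)
  obtain ⟨δ, hδ, -, hδR⟩ := hΦ.exists_log_rpow_le le_rfl one_pos (M := 0)
  obtain ⟨R, hR0, hR⟩ := exists_between (lt_min hδ hC₁)
  have hRΦ := (hδR R hR0 (hR.trans_le (min_le_left _ _))).1
  obtain ⟨c, hc, h1⟩ := ball_lower_bound_of_ratio (μ := μ) (hμν ▸ hν) (δ := R ^ (1 + Φ R)) hR0 hC₂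
    (d := d) fun x hx r hr hrR => by
      have := hd r R hr hrR hRΦ.le (hR.le.trans (min_le_right _ _)) x hx
      rw [measure_ball_div hx hr, ENNReal.ofReal_le_ofReal_iff (by positivity),
        div_le_iff₀ (measureReal_ball_pos hx hr)] at this
      exact this
  obtain ⟨_, _, C, hC, δ', hδ', h2⟩ := h.exists_ball_bounds hν hε
  rw [hμν] at h1
  have := exponent_le_of_ball_bounds (μ := μ) hν hc hC
    (lt_min hδ' (Real.rpow_pos_of_pos hR0 (1 + Φ R)))
    (fun x hx r hr hr' => h1 x hx r hr (hr'.trans_le (min_le_right _ _)))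
    (fun x hx r hr hr' => (h2 x hx r hr (hr'.trans_le (min_le_left _ _))).2)
  linarith

/-- If the lower dimension of `μ` exceeded `D`, then the small balls of `μ` would be too light to
fill a support of box dimension `D`. -/
theorem lowerDimMeasure_le (h : IsLogRegular ν D) (hν : IsCompact ν.support)
    (hμν : μ.support = ν.support) {Φ : ℝ → ℝ} (hΦ : IsLarge Φ) :
    lowerDimMeasure Φ μ ≤ (D : EReal) := by
  refine sSup_le ?_
  rintro _ ⟨d, ⟨C₁, hC₁, C₂, hC₂, hd⟩, rfl⟩
  refine EReal.coe_le_coe_iff.2 (le_of_forall_pos_le_add fun ε hε => ?_)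
  obtain ⟨δ, hδ, -, hδR⟩ := hΦ.exists_log_rpow_le le_rfl one_pos (M := 0)
  obtain ⟨R, hR0, hR⟩ := exists_between (lt_min hδ hC₁)
  have hRΦ := (hδR R hR0 (hR.trans_le (min_le_left _ _))).1
  obtain ⟨C, hC, h1⟩ := ball_upper_bound_of_ratio (μ := μ) (δ := R ^ (1 + Φ R)) hR0 hC₂
    (d := d) fun x hx r hr hrR => by
      have := hd r R hr hrR hRΦ.le (hR.le.trans (min_le_right _ _)) x hx
      rw [measure_ball_div hx hr, ENNReal.ofReal_le_ofReal_iff (by positivity),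
        le_div_iff₀ (measureReal_ball_pos hx hr)] at this
      exact this
  obtain ⟨c, hc, _, _, δ', hδ', h2⟩ := h.exists_ball_bounds hν hε
  have hμ : IsCompact μ.support := hμν ▸ hν
  rw [← hμν] at h2
  exact exponent_le_of_ball_bounds (μ := ν) (ν := μ) hμ hc hC
    (lt_min hδ' (Real.rpow_pos_of_pos hR0 (1 + Φ R)))
    (fun x hx r hr hr' => (h2 x hx r hr (hr'.trans_le (min_le_left _ _))).1)
    (fun x hx r hr hr' => h1 x hx r hr (hr'.trans_le (min_le_right _ _)))

theorem upperDimMeasure_eq (h : IsLogRegular ν D) (hν : IsCompact ν.support) {Φ : ℝ → ℝ}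
    (hΦ : IsLarge Φ) : upperDimMeasure Φ ν = D := by
  refine sInf_image_coe_eq (fun ε hε => ?_) fun d hd => ?_
  · obtain ⟨C, hC, δ, hδ, hb⟩ := h.exists_ratio_bounds hΦ hε
    refine ⟨δ / 2, half_pos hδ, C, hC, fun r R hr hrΦ hΦR hRδ x hx => ?_⟩
    rw [measure_ball_div hx hr]
    refine ENNReal.ofReal_le_ofReal ((div_le_iff₀ (measureReal_ball_pos hx hr)).2 ?_)
    exact (hb x hx r R hr hrΦ.le (hrΦ.le.trans hΦR) (by linarith)).1
  · have := (h.le_upperDimMeasure hν (μ := ν) rfl hΦ).trans (sInf_le ⟨d, hd, rfl⟩)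
    exact EReal.coe_le_coe_iff.1 this

theorem lowerDimMeasure_eq (h : IsLogRegular ν D) (hν : IsCompact ν.support) {Φ : ℝ → ℝ}
    (hΦ : IsLarge Φ) : lowerDimMeasure Φ ν = D := by
  refine sSup_image_coe_eq (fun ε hε => ?_) fun d hd => ?_
  · obtain ⟨C, hC, δ, hδ, hb⟩ := h.exists_ratio_bounds hΦ hε
    refine ⟨δ / 2, half_pos hδ, C⁻¹, inv_pos.2 hC, fun r R hr hrΦ hΦR hRδ x hx => ?_⟩
    rw [measure_ball_div hx hr]
    refine ENNReal.ofReal_le_ofReal ((le_div_iff₀ (measureReal_ball_pos hx hr)).2 ?_)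
    rw [mul_assoc, inv_mul_le_iff₀ hC]
    exact (hb x hx r R hr hrΦ.le (hrΦ.le.trans hΦR) (by linarith)).2
  · have hdl : (d : EReal) ≤ lowerDimMeasure Φ ν := le_sSup (mem_image_of_mem _ hd)
    exact EReal.coe_le_coe_iff.1 (hdl.trans (h.lowerDimMeasure_le hν (μ := ν) rfl hΦ))

end IsLogRegular

end LogRegular

end PhiDim

/-! ### Dimensions of the support of a log-regular measure -/

namespace PhiDim

section LogRegularSupport

variable {X : Type*} [MetricSpace X] [MeasurableSpace X]
  {ν : Measure X} [IsProbabilityMeasure ν]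

namespace IsLogRegular

variable {D : ℝ}

/-- Covering numbers of the pieces `B(z,R) ∩ supp ν` from below. The masses of the balls `B(x,R)`
with `x` in the piece are compared with that of `B(z,R)` through `B(z,2R)`, which costs a second
power of `|log R|`. -/
lemma le_coveringNumber [SecondCountableTopology X] (h : IsLogRegular ν D)
    (hν : IsCompact ν.support) {ε : ℝ} (hε : 0 < ε) :
    ∃ M ≥ (0 : ℝ), ∃ C > (0 : ℝ), ∃ δ > (0 : ℝ), ∀ z ∈ ν.support, ∀ r R, 0 < r → 2 * r ≤ R →
      R < δ → ∀ n : ℕ, coveringNumber r (Metric.ball z R ∩ ν.support) = n →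
        (R / r) ^ (D - ε) ≤ C * (1 + |Real.log R|) ^ M * n := by
  obtain ⟨M, hM, C, hC, δ, hδ, hδ1, hb⟩ := h ε hε
  refine ⟨2 * M, by positivity, 2 ^ (D - ε) * (C ^ 2 * 2 ^ (D + ε)), by positivity, δ / 2,
    by positivity, ?_⟩
  intro z hz r R hr hrR hRδ n hn
  have hR : 0 < R := by linarith
  have hE : TotallyBounded (Metric.ball z R ∩ ν.support) :=
    hν.totallyBounded.subset inter_subset_right
  set L := (1 + |Real.log R|) ^ M with hL
  have hL0 : 0 < L := by positivity
  have hlog : |Real.log (2 * R)| ≤ |Real.log R| := by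
    have h1 : Real.log (2 * R) < 0 := Real.log_neg (by positivity) (by linarith)
    have h2 : Real.log R ≤ Real.log (2 * R) := Real.log_le_log hR (by linarith)
    rw [abs_of_neg h1, abs_of_nonpos (by linarith)]
    linarith
  set m := ν.real (Metric.ball z R) with hm
  have hm0 : 0 < m := measureReal_ball_pos hz hR
  have hP : 0 < (R / (2 * r)) ^ (D - ε) := by positivity
  have hmE : ν.real (Metric.ball z R ∩ ν.support) = m := by
    rw [measureReal_def, measure_inter_conull Measure.measure_compl_support]
    rfl
  have h1 := measureReal_le_coveringNumber_mul (μ := ν) hE hr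
    (b := C ^ 2 * L ^ 2 * 2 ^ (D + ε) * m / (R / (2 * r)) ^ (D - ε)) (by positivity) hn
    fun x hx => ?_
  · rw [hmE, mul_div_assoc', le_div_iff₀ hP] at h1
    have h2 : (R / (2 * r)) ^ (D - ε) ≤ C ^ 2 * L ^ 2 * 2 ^ (D + ε) * n := by
      refine le_of_mul_le_mul_left ?_ hm0
      linarith
    have e : R / r = 2 * (R / (2 * r)) := by field_simp
    have e' : (1 + |Real.log R|) ^ (2 * M) = L ^ 2 := by
      rw [mul_comm, Real.rpow_mul (by positivity), Real.rpow_two]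
    rw [e, e', Real.mul_rpow (by norm_num) (by positivity)]
    calc (2 : ℝ) ^ (D - ε) * (R / (2 * r)) ^ (D - ε)
        ≤ 2 ^ (D - ε) * (C ^ 2 * L ^ 2 * 2 ^ (D + ε) * n) := by gcongr
      _ = _ := by ring
  · have hxz : dist x z < R := hx.1
    rw [le_div_iff₀ hP, mul_comm]
    calc (R / (2 * r)) ^ (D - ε) * ν.real (Metric.ball x (2 * r))
        ≤ C * L * ν.real (Metric.ball x R) :=
          (hb x hx.2 (2 * r) R (by positivity) hrR (by linarith)).2
      _ ≤ C * L * ν.real (Metric.ball z (2 * R)) := by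
          gcongr
          · exact measure_ne_top _ _
          · exact Metric.ball_subset_ball' (by linarith)
      _ ≤ C * L * (C * (1 + |Real.log (2 * R)|) ^ M * (2 * R / R) ^ (D + ε) * m) := by
          gcongr
          exact (hb z hz R (2 * R) hR (by linarith) (by linarith)).1
      _ ≤ C * L * (C * L * 2 ^ (D + ε) * m) := by
          rw [mul_div_assoc, div_self hR.ne', mul_one, hL]
          gcongr
      _ = _ := by ring

variable [BorelSpace X]

/-- Covering numbers of the pieces `B(z,R) ∩ supp ν` from above: each ball of radius `r / 2` centred
in the piece carries a fixed proportion of the mass of `B(z,2R)`, since `B(z,2R) ⊆ B(x,3R)`. -/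
lemma coveringNumber_le (h : IsLogRegular ν D) (hν : IsCompact ν.support) {ε : ℝ} (hε : 0 < ε) :
    ∃ M ≥ (0 : ℝ), ∃ C > (0 : ℝ), ∃ δ > (0 : ℝ), ∀ z ∈ ν.support, ∀ r R, 0 < r → r ≤ R → R < δ →
      ∀ n : ℕ, coveringNumber r (Metric.ball z R ∩ ν.support) = n →
        n ≤ C * (1 + |Real.log R|) ^ M * (R / r) ^ (D + ε) := by
  obtain ⟨M, hM, C, hC, δ, hδ, hδ1, hb⟩ := h ε hε
  refine ⟨M, hM, C * 6 ^ (D + ε), by positivity, δ / 3, by positivity, ?_⟩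
  intro z hz r R hr hrR hRδ n hn
  have hR : 0 < R := hr.trans_le hrR
  have hE : TotallyBounded (Metric.ball z R ∩ ν.support) :=
    hν.totallyBounded.subset inter_subset_right
  set b := ν.real (Metric.ball z (2 * R)) with hb'
  have hb0 : 0 < b := measureReal_ball_pos hz (by positivity)
  set K := C * (1 + |Real.log R|) ^ M * (6 * (R / r)) ^ (D + ε) with hK
  have hK0 : 0 < K := by positivity
  have hlog : |Real.log (3 * R)| ≤ |Real.log R| := by
    have h1 : Real.log (3 * R) < 0 := Real.log_neg (by positivity) (by linarith)
    have h2 : Real.log R ≤ Real.log (3 * R) := Real.log_le_log hR (by linarith)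
    rw [abs_of_neg h1, abs_of_nonpos (by linarith)]
    linarith
  have h1 := coveringNumber_mul_le_measureReal (μ := ν) (U := Metric.ball z (2 * R)) hE hr
    (c := b / K) (by positivity) hn (fun x hx => ?_) fun x hx => ?_
  · rw [mul_div_assoc', div_le_iff₀ hK0, mul_comm b] at h1
    have h2 := le_of_mul_le_mul_right h1 hb0
    rw [hK, Real.mul_rpow (by norm_num) (by positivity)] at h2
    linarith
  · have hxz : dist x z < R := hx.1
    rw [div_le_iff₀ hK0, mul_comm]
    calc b ≤ ν.real (Metric.ball x (3 * R)) :=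
          measureReal_mono (Metric.ball_subset_ball' (by rw [dist_comm]; linarith))
      _ ≤ C * (1 + |Real.log (3 * R)|) ^ M * (3 * R / (r / 2)) ^ (D + ε)
            * ν.real (Metric.ball x (r / 2)) :=
          (hb x hx.2 (r / 2) (3 * R) (by positivity) (by linarith) (by linarith)).1
      _ ≤ K * ν.real (Metric.ball x (r / 2)) := by
          have e : 3 * R / (r / 2) = 6 * (R / r) := by field_simp; norm_num
          rw [e, hK]
          gcongr
  · have hxz : dist x z < R := hx.1
    exact Metric.ball_subset_ball' (by linarith)

open scoped NNReal in
/-- The upper bound for the Hausdorff dimension: the support is covered by about `r ^ (-D)` balls of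
radius `r`. -/
lemma dimH_support_le (h : IsLogRegular ν D) (hν : IsCompact ν.support) {s : ℝ≥0} (hs : D < s) :
    dimH ν.support ≤ s := by
  obtain ⟨c, hc, _, _, δ, hδ, hb⟩ := h.exists_ball_bounds hν (sub_pos.2 hs)
  rw [add_sub_cancel] at hb
  refine dimH_le_of_hausdorffMeasure_ne_top (ne_top_of_le_ne_top
    (ENNReal.ofReal_ne_top (r := 4 ^ (s : ℝ) / c)) ?_)
  have hr0 : ∀ k : ℕ, 0 < δ / ((k : ℝ) + 1) := fun k => by positivity
  choose S hScov hSn using fun k : ℕ =>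
    exists_finset_card_eq_coveringNumber hν.totallyBounded (hr0 k)
  have hlim : Tendsto (fun k : ℕ => ENNReal.ofReal (2 * (δ / ((k : ℝ) + 1)))) atTop (𝓝 0) := by
    have h1 : Tendsto (fun k : ℕ => 2 * (δ / ((k : ℝ) + 1))) atTop (𝓝 (2 * 0)) :=
      (tendsto_const_nhds.div_atTop
        (tendsto_atTop_add_const_right _ _ tendsto_natCast_atTop_atTop)).const_mul 2
    simpa using ENNReal.tendsto_ofReal h1
  have hdiam : ∀ k (y : X), Metric.ediam (Metric.ball y (δ / ((k : ℕ) + 1)))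
      ≤ ENNReal.ofReal (2 * (δ / ((k : ℝ) + 1))) := fun k y => by
    rw [← Metric.eball_ofReal, ENNReal.ofReal_mul two_pos.le]
    simpa only [ENNReal.ofReal_ofNat] using Metric.ediam_eball_le (x := y)
  refine (Measure.hausdorffMeasure_le_liminf_sum (ι := fun k => S k) (s : ℝ) ν.support _ hlim
    (fun k y => Metric.ball (y : X) (δ / ((k : ℝ) + 1))) (.of_forall fun k y => hdiam k y)
    (.of_forall fun k x hx => ?_)).trans ?_
  · obtain ⟨y, hy, hxy⟩ := mem_iUnion₂.1 (hScov k hx)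
    exact mem_iUnion.2 ⟨⟨y, hy⟩, hxy⟩
  refine liminf_le_of_le (by isBoundedDefault) fun b hb' => ?_
  obtain ⟨k, hk⟩ := hb'.exists
  refine hk.trans ?_
  set r := δ / ((k : ℝ) + 1) with hr
  have hrδ : r ≤ δ := div_le_self hδ.le (by linarith [k.cast_nonneg (α := ℝ)])
  have hcard := coveringNumber_mul_le_measureReal (μ := ν) (U := univ) hν.totallyBounded (hr0 k)
    (c := c * (r / 2) ^ (s : ℝ)) (by positivity) (hSn k)
    (fun x hx => (hb x hx (r / 2) (half_pos (hr0 k)) (by linarith [hr0 k])).1)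
    fun _ _ => subset_univ _
  rw [probReal_univ] at hcard
  calc ∑ y : S k, Metric.ediam (Metric.ball (y : X) r) ^ (s : ℝ)
      ≤ ∑ _y : S k, ENNReal.ofReal ((2 * r) ^ (s : ℝ)) := by
        refine Finset.sum_le_sum fun y _ => ?_
        rw [← ENNReal.ofReal_rpow_of_nonneg (by positivity) s.coe_nonneg]
        exact ENNReal.rpow_le_rpow (hdiam k y) s.coe_nonneg
    _ = ENNReal.ofReal ((S k).card * (2 * r) ^ (s : ℝ)) := by
        rw [Finset.sum_const, Finset.card_univ, Fintype.card_coe, nsmul_eq_mul,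
          ENNReal.ofReal_mul (by positivity), ENNReal.ofReal_natCast]
    _ ≤ ENNReal.ofReal (4 ^ (s : ℝ) / c) := by
        refine ENNReal.ofReal_le_ofReal ?_
        have e : 2 * r = 4 * (r / 2) := by ring
        rw [e, Real.mul_rpow (by norm_num) (half_pos (hr0 k)).le, le_div_iff₀ hc]
        have : 0 < (4 : ℝ) ^ (s : ℝ) := by positivity
        nlinarith

variable [SecondCountableTopology X]

theorem upperDimSet_support (h : IsLogRegular ν D) (hν : IsCompact ν.support) {Φ : ℝ → ℝ}
    (hΦ : IsLarge Φ) : upperDimSet Φ ν.support = D := by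
  refine sInf_image_coe_eq (fun ε hε => ?_) fun d ⟨C₁, hC₁, C₂, hC₂, hd⟩ =>
    le_of_forall_pos_le_add fun ε hε => ?_
  · obtain ⟨M, hM, C, hC, δ, hδ, hb⟩ := h.coveringNumber_le hν (half_pos hε)
    obtain ⟨δ', hδ', -, hδR⟩ := hΦ.exists_log_rpow_le (M := M) hM (half_pos hε)
    refine ⟨min δ δ', lt_min hδ hδ', C, hC, fun r R hr hrΦ hΦR hRδ z hz => ?_⟩
    have hrR := hrΦ.trans hΦR.le
    have hR : 0 < R := hr.trans_le hrR
    have hRr : 0 < R / r := div_pos hR hr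
    obtain ⟨n, hn⟩ := exists_nat_eq_coveringNumber (E := Metric.ball z R ∩ ν.support)
      (hν.totallyBounded.subset inter_subset_right) hr
    rw [hn, ENat.toENNReal_coe, ← ENNReal.ofReal_natCast]
    refine ENNReal.ofReal_le_ofReal
      ((hb z hz r R hr hrR (hRδ.trans_le (min_le_left _ _)) n hn).trans ?_)
    have hlog := ((hδR R hR (hRδ.trans_le (min_le_right _ _))).2 r hr hrΦ).2
    have e : D + ε = ε / 2 + (D + ε / 2) := by ring
    rw [e, Real.rpow_add hRr (ε / 2), ← mul_assoc]
    gcongr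
  · obtain ⟨M, hM, C, hC, δ, hδ, hb⟩ := h.le_coveringNumber hν hε
    obtain ⟨δ', hδ', -, hδR⟩ := hΦ.exists_log_rpow_le (M := 0) le_rfl one_pos
    obtain ⟨R, hR, hRδ⟩ := exists_between (lt_min (lt_min hδ hδ') hC₁)
    rw [lt_min_iff, lt_min_iff] at hRδ
    obtain ⟨hΦR, hRr⟩ := hδR R hR hRδ.1.2
    obtain ⟨z, hz⟩ := Measure.nonempty_support (IsProbabilityMeasure.ne_zero ν)
    have hRΦ : 0 < R ^ (1 + Φ R) := by positivity
    have := le_of_forall_mul_rpow_le (a := D - ε) (b := d) (c := 1)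
      (C := C * (1 + |Real.log R|) ^ M * C₂) (T := R / R ^ (1 + Φ R)) one_pos fun t ht ht0 => by
        have hr0 : 0 < R / t := by positivity
        have hrΦ : R / t ≤ R ^ (1 + Φ R) := by
          rw [ge_iff_le, div_le_iff₀ hRΦ] at ht
          rw [div_le_iff₀ ht0]
          linarith
        obtain ⟨n, hn⟩ := exists_nat_eq_coveringNumber (E := Metric.ball z R ∩ ν.support)
          (hν.totallyBounded.subset inter_subset_right) hr0
        have h1 := hb z hz _ R hr0 (hRr _ hr0 hrΦ).1 hRδ.1.1 n hn
        have h2 := hd _ R hr0 hrΦ hΦR hRδ.2 z hz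
        rw [hn, ENat.toENNReal_coe, ← ENNReal.ofReal_natCast,
          ENNReal.ofReal_le_ofReal_iff (by positivity), div_div_cancel₀ hR.ne'] at h2
        rw [div_div_cancel₀ hR.ne'] at h1
        rw [one_mul, mul_assoc]
        exact h1.trans (by gcongr)
    linarith

theorem lowerDimSet_support (h : IsLogRegular ν D) (hν : IsCompact ν.support) {Φ : ℝ → ℝ}
    (hΦ : IsLarge Φ) : lowerDimSet Φ ν.support = D := by
  refine sSup_image_coe_eq (fun ε hε => ?_) fun d ⟨C₁, hC₁, C₂, hC₂, hd⟩ =>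
    le_of_forall_pos_le_add fun ε hε => ?_
  · obtain ⟨M, hM, C, hC, δ, hδ, hb⟩ := h.le_coveringNumber hν (half_pos hε)
    obtain ⟨δ', hδ', -, hδR⟩ := hΦ.exists_log_rpow_le (M := M) hM (half_pos hε)
    refine ⟨min δ δ', lt_min hδ hδ', C⁻¹, inv_pos.2 hC, fun r R hr hrΦ hΦR hRδ z hz => ?_⟩
    have hrR := hrΦ.trans hΦR.le
    have hR : 0 < R := hr.trans_le hrR
    have hRr : 0 < R / r := div_pos hR hr
    obtain ⟨n, hn⟩ := exists_nat_eq_coveringNumber (E := Metric.ball z R ∩ ν.support)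
      (hν.totallyBounded.subset inter_subset_right) hr
    rw [hn, ENat.toENNReal_coe, ← ENNReal.ofReal_natCast]
    refine ENNReal.ofReal_le_ofReal ?_
    obtain ⟨h2r, hlog⟩ := (hδR R hR (hRδ.trans_le (min_le_right _ _))).2 r hr hrΦ
    have h1 := hb z hz r R hr h2r (hRδ.trans_le (min_le_left _ _)) n hn
    have e : D - ε / 2 = ε / 2 + (D - ε) := by ring
    rw [e, Real.rpow_add hRr] at h1
    have h2 : (R / r) ^ (ε / 2) * (R / r) ^ (D - ε) ≤ C * (R / r) ^ (ε / 2) * n :=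
      h1.trans (by gcongr)
    have h3 : 0 < (R / r) ^ (ε / 2) := by positivity
    rw [inv_mul_le_iff₀ hC]
    refine le_of_mul_le_mul_left ?_ h3
    linarith
  · obtain ⟨M, hM, C, hC, δ, hδ, hb⟩ := h.coveringNumber_le hν hε
    obtain ⟨δ', hδ', -, hδR⟩ := hΦ.exists_log_rpow_le (M := 0) le_rfl one_pos
    obtain ⟨R, hR, hRδ⟩ := exists_between (lt_min (lt_min hδ hδ') hC₁)
    rw [lt_min_iff, lt_min_iff] at hRδ
    obtain ⟨hΦR, hRr⟩ := hδR R hR hRδ.1.2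
    obtain ⟨z, hz⟩ := Measure.nonempty_support (IsProbabilityMeasure.ne_zero ν)
    have hRΦ : 0 < R ^ (1 + Φ R) := by positivity
    exact le_of_forall_mul_rpow_le (a := d) (b := D + ε) (c := C₂)
      (C := C * (1 + |Real.log R|) ^ M) (T := R / R ^ (1 + Φ R)) hC₂ fun t ht ht0 => by
        have hr0 : 0 < R / t := by positivity
        have hrΦ : R / t ≤ R ^ (1 + Φ R) := by
          rw [ge_iff_le, div_le_iff₀ hRΦ] at ht
          rw [div_le_iff₀ ht0]
          linarith
        obtain ⟨n, hn⟩ := exists_nat_eq_coveringNumber (E := Metric.ball z R ∩ ν.support)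
          (hν.totallyBounded.subset inter_subset_right) hr0
        have h1 := hb z hz _ R hr0 (hrΦ.trans hΦR.le) hRδ.1.1 n hn
        have h2 := hd _ R hr0 hrΦ hΦR hRδ.2 z hz
        rw [hn, ENat.toENNReal_coe, ← ENNReal.ofReal_natCast,
          ENNReal.ofReal_le_ofReal_iff (by positivity), div_div_cancel₀ hR.ne'] at h2
        rw [div_div_cancel₀ hR.ne'] at h1
        exact h2.trans h1

open scoped NNReal in
/-- The mass distribution principle: the balls of `ν` have mass at most about `r ^ D`. -/
lemma le_dimH_support (h : IsLogRegular ν D) (hν : IsCompact ν.support) {s : ℝ≥0} (hs : s < D) :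
    s ≤ dimH ν.support := by
  obtain ⟨_, _, C, hC, δ, hδ, hb⟩ := h.exists_ball_bounds hν (sub_pos.2 hs)
  rw [sub_sub_cancel] at hb
  have hC' : ENNReal.ofReal C ≠ 0 := by simpa using hC
  have key : (ENNReal.ofReal C)⁻¹ • ν ≤ Measure.hausdorffMeasure (s : ℝ) := by
    refine Measure.le_mkMetric _ _ (ENNReal.ofReal (δ / 2)) (by simpa using hδ) fun t ht => ?_
    rw [Measure.smul_apply, smul_eq_mul, ← ENNReal.div_eq_inv_mul]
    refine ENNReal.div_le_of_le_mul' ?_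
    rcases (t ∩ ν.support).eq_empty_or_nonempty with he | ⟨x, hxt, hx⟩
    · have : ν t = 0 := measure_mono_null
        (fun y hy hy' => (he ▸ ⟨hy, hy'⟩ : y ∈ (∅ : Set X))) Measure.measure_compl_support
      simp [this]
    have hfin : Metric.ediam t ≠ ∞ := ne_top_of_le_ne_top ENNReal.ofReal_ne_top ht
    set a := (Metric.ediam t).toReal with ha
    have haδ : a ≤ δ / 2 := ENNReal.toReal_le_of_le_ofReal (by positivity) ht
    have hball : ∀ r ∈ Ioo a δ, ν t ≤ ENNReal.ofReal (C * r ^ (s : ℝ)) := by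
      intro r hr
      have hr0 : 0 < r := ENNReal.toReal_nonneg.trans_lt hr.1
      have hsub : t ⊆ Metric.ball x r := fun y hy => by
        have h1 := Metric.edist_le_ediam_of_mem hy hxt
        rw [Metric.mem_ball, dist_edist]
        exact (ENNReal.toReal_mono hfin h1).trans_lt hr.1
      refine (measure_mono hsub).trans ?_
      rw [← ofReal_measureReal]
      exact ENNReal.ofReal_le_ofReal (hb x hx r hr0 hr.2).2
    -- letting `r` decrease to the diameter also covers sets of diameter `0`
    have hlim : Tendsto (fun r : ℝ => ENNReal.ofReal (C * r ^ (s : ℝ))) (𝓝[>] a)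
        (𝓝 (ENNReal.ofReal (C * a ^ (s : ℝ)))) := by
      refine ENNReal.tendsto_ofReal (Tendsto.const_mul C ?_)
      exact (Real.continuousAt_rpow_const a s
        (Or.inr s.coe_nonneg)).tendsto.mono_left nhdsWithin_le_nhds
    have hle := ge_of_tendsto hlim
      (mem_of_superset (Ioo_mem_nhdsGT (by linarith : a < δ)) hball)
    rwa [ENNReal.ofReal_mul hC.le,
      ← ENNReal.ofReal_rpow_of_nonneg ENNReal.toReal_nonneg s.coe_nonneg,
      ENNReal.ofReal_toReal hfin] at hle
  refine le_dimH_of_hausdorffMeasure_ne_zero fun h0 => ?_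
  have h1 := key ν.support
  rw [h0, Measure.smul_apply, smul_eq_mul, prob_compl_eq_zero_iff₀
    Measure.nullMeasurableSet_support |>.1 Measure.measure_compl_support, mul_one] at h1
  simp at h1

theorem dimH_support (h : IsLogRegular ν D) (hν : IsCompact ν.support) (hD : 0 < D) :
    (dimH ν.support : EReal) = D := by
  have hD' : dimH ν.support = ENNReal.ofReal D := by
    refine le_antisymm (ENNReal.le_of_forall_pos_le_add fun ε hε _ => ?_)
      (ENNReal.le_of_forall_nnreal_lt fun s hs => ?_)
    · have : D < (D.toNNReal + ε : NNReal) := by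
        rw [NNReal.coe_add, Real.coe_toNNReal _ hD.le]
        exact lt_add_of_pos_right _ hε
      simpa [ENNReal.ofReal] using h.dimH_support_le hν this
    · refine h.le_dimH_support hν ?_
      rw [ENNReal.ofReal, ENNReal.coe_lt_coe] at hs
      have := NNReal.coe_lt_coe.2 hs
      rwa [Real.coe_toNNReal _ hD.le] at this
  rw [hD', EReal.coe_ennreal_ofReal, max_eq_left hD.le]

end IsLogRegular

end LogRegularSupport

end PhiDim

/-! ### Block sums of independent sub-Gaussian variables -/

namespace PhiDim

section Fluctuations

open ProbabilityTheory

variable {Ω : Type*} [MeasurableSpace Ω] {μ : Measure Ω}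

/-- Chernoff's bound at `t = ε / (c + 1)`. The multiple of `log (N + 2)` in the threshold is chosen
to produce the summable factor `(N + 2) ^ (-2)`; `c + 1` instead of `c` avoids dividing by `0`. -/
lemma measureReal_sum_ge_le [IsFiniteMeasure μ] {X : ℕ → Ω → ℝ} (hX : iIndepFun X μ) {c : NNReal}
    (hc : ∀ k, HasSubgaussianMGF (X k) c μ) {ε : ℝ} (hε : 0 < ε) (N n : ℕ) :
    μ.real {ω | ε * n + 2 * (c + 1) / ε * Real.log (N + 2)
        ≤ ∑ k ∈ Finset.range n, X (N + k) ω}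
      ≤ (((N : ℝ) + 2) ^ 2)⁻¹ * Real.exp (-ε ^ 2 / (2 * (c + 1))) ^ n := by
  have hc1 : (0 : ℝ) < c + 1 := by positivity
  have hN : (0 : ℝ) < N + 2 := by positivity
  have hS : HasSubgaussianMGF (fun ω => ∑ k ∈ Finset.range n, X (N + k) ω)
      (∑ _k ∈ Finset.range n, c) μ :=
    HasSubgaussianMGF.sum_of_iIndepFun (X := fun k => X (N + k))
      (hX.precomp (add_right_injective N)) fun k _ => hc (N + k)
  set t : ℝ := ε / (c + 1) with ht
  have ht0 : 0 ≤ t := by positivity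
  refine (measure_ge_le_exp_mul_mgf _ ht0 (hS.integrable_exp_mul t)).trans ?_
  have h1 := hS.mgf_le t
  refine (mul_le_mul_of_nonneg_left h1 (Real.exp_nonneg _)).trans ?_
  have h2 : (((N : ℝ) + 2) ^ 2)⁻¹ = Real.exp (-(2 * Real.log (N + 2))) := by
    rw [Real.exp_neg, ← Real.log_rpow hN, Real.exp_log (by positivity)]
    norm_num
  rw [h2, ← Real.exp_nat_mul, ← Real.exp_add, ← Real.exp_add, Real.exp_le_exp]
  simp only [Finset.sum_const, Finset.card_range, nsmul_eq_mul, NNReal.coe_mul, NNReal.coe_natCast]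
  have h3 : t ^ 2 * (c + 1) = ε ^ 2 / (c + 1) := by rw [ht]; field_simp
  have h4 : t * (2 * (c + 1) / ε * Real.log (N + 2)) = 2 * Real.log (N + 2) := by
    rw [ht]; field_simp
  have h5 : t * (ε * n) = ε ^ 2 / (c + 1) * n := by rw [ht]; ring
  have h6 : (n : ℝ) * (-ε ^ 2 / (2 * (c + 1))) = -(ε ^ 2 / (c + 1) * n) / 2 := by
    field_simp
  have h7 : (n : ℝ) * c * t ^ 2 / 2 ≤ ε ^ 2 / (c + 1) * n / 2 := by
    rw [← h3]
    have : 0 ≤ t ^ 2 * (n : ℝ) := by positivity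
    nlinarith
  rw [h6, neg_mul, mul_add, h4, h5]
  linarith

lemma summable_inv_sq_mul_geometric {q : ℝ} (hq0 : 0 ≤ q) (hq1 : q < 1) :
    Summable fun p : ℕ × ℕ => (((p.1 : ℝ) + 2) ^ 2)⁻¹ * q ^ p.2 := by
  refine Summable.mul_of_nonneg (f := fun N : ℕ => (((N : ℝ) + 2) ^ 2)⁻¹) ?_
    (summable_geometric_of_lt_one hq0 hq1) (fun N => by positivity) (fun n => by positivity)
  have := (summable_nat_add_iff 2).2 (Real.summable_nat_pow_inv (p := 2).2 one_lt_two)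
  simpa using this

lemma ae_exists_sum_le [IsFiniteMeasure μ] {X : ℕ → Ω → ℝ} (hX : iIndepFun X μ) {c : NNReal}
    (hc : ∀ k, HasSubgaussianMGF (X k) c μ) {ε : ℝ} (hε : 0 < ε) :
    ∀ᵐ ω ∂μ, ∃ M : ℝ, ∀ N n : ℕ,
      ∑ k ∈ Finset.range n, X (N + k) ω ≤ ε * n + M * Real.log (N + 2) := by
  have hc1 : (0 : ℝ) < c + 1 := by positivity
  set q := Real.exp (-ε ^ 2 / (2 * (c + 1))) with hq
  have hq1 : q < 1 := by
    rw [hq, Real.exp_lt_one_iff, neg_div]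
    exact neg_neg_of_pos (by positivity)
  have hsum : ∑' p : ℕ × ℕ, μ {ω | ε * p.2 + 2 * (c + 1) / ε * Real.log (p.1 + 2)
      ≤ ∑ k ∈ Finset.range p.2, X (p.1 + k) ω} ≠ ∞ := by
    refine ne_top_of_le_ne_top
      (summable_inv_sq_mul_geometric (Real.exp_nonneg _) hq1).tsum_ofReal_ne_top
      (ENNReal.tsum_le_tsum fun p => ?_)
    rw [ENNReal.le_ofReal_iff_toReal_le (measure_ne_top _ _) (by positivity)]
    exact measureReal_sum_ge_le hX hc hε p.1 p.2
  filter_upwards [ae_finite_setOfPred_mem hsum] with ω hω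
  -- the finitely many exceptional pairs only affect the constant
  obtain ⟨b, hb⟩ := (hω.image fun p => ∑ k ∈ Finset.range p.2, X (p.1 + k) ω).bddAbove
  have hlog2 : 0 < Real.log 2 := Real.log_pos one_lt_two
  refine ⟨2 * (c + 1) / ε + |b| / Real.log 2, fun N n => ?_⟩
  have hlog : Real.log 2 ≤ Real.log (N + 2) :=
    Real.log_le_log two_pos (by linarith [N.cast_nonneg (α := ℝ)])
  have h1 : |b| ≤ |b| / Real.log 2 * Real.log (N + 2) := by
    rw [div_mul_eq_mul_div, le_div_iff₀ hlog2]
    exact mul_le_mul_of_nonneg_left hlog (abs_nonneg b)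
  have h2 : 0 ≤ 2 * (c + 1) / ε * Real.log (N + 2) := by
    have := hlog2.trans_le hlog
    positivity
  have h3 : 0 ≤ ε * n := by positivity
  rw [add_mul]
  by_cases h : (N, n) ∈ {p : ℕ × ℕ | ω ∈ {ω | ε * p.2 + 2 * (c + 1) / ε * Real.log (p.1 + 2)
      ≤ ∑ k ∈ Finset.range p.2, X (p.1 + k) ω}}
  · have := hb (mem_image_of_mem _ h)
    linarith [le_abs_self b]
  · simp only [mem_ofPred_eq, not_le] at h
    linarith [abs_nonneg b]

/-- Borel–Cantelli and Hoeffding's inequality control all the block sums of an independent centred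
sequence at once: the block of length `n` after the time `N` exceeds `ε n` by at most a constant
times `log (N + 2)`. -/
theorem ae_forall_exists_abs_sum_le [IsFiniteMeasure μ] {X : ℕ → Ω → ℝ} (hX : iIndepFun X μ)
    {c : NNReal} (hc : ∀ k, HasSubgaussianMGF (X k) c μ) :
    ∀ᵐ ω ∂μ, ∀ ε > 0, ∃ M : ℝ, 0 ≤ M ∧ ∀ N n : ℕ,
      |∑ k ∈ Finset.range n, X (N + k) ω| ≤ ε * n + M * Real.log (N + 2) := by
  have key : ∀ j : ℕ, ∀ᵐ ω ∂μ, ∃ M : ℝ, 0 ≤ M ∧ ∀ N n : ℕ,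
      |∑ k ∈ Finset.range n, X (N + k) ω| ≤ 1 / ((j : ℝ) + 1) * n + M * Real.log (N + 2) := by
    intro j
    have hj : 0 < 1 / ((j : ℝ) + 1) := by positivity
    have hX' : iIndepFun (fun k => -X k) μ := hX.comp (fun _ x => -x) fun _ => measurable_neg
    filter_upwards [ae_exists_sum_le hX hc hj, ae_exists_sum_le hX' (fun k => (hc k).neg) hj]
      with ω ⟨M₁, h₁⟩ ⟨M₂, h₂⟩
    refine ⟨|M₁| + |M₂|, by positivity, fun N n => ?_⟩
    have hlog : 0 ≤ Real.log (N + 2) := Real.log_nonneg (by linarith [N.cast_nonneg (α := ℝ)])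
    have h3 := h₁ N n
    have h4 := h₂ N n
    simp only [Pi.neg_apply, Finset.sum_neg_distrib] at h4
    have h5 := mul_le_mul_of_nonneg_right (le_abs_self M₁) hlog
    have h6 := mul_le_mul_of_nonneg_right (le_abs_self M₂) hlog
    have h7 := mul_nonneg (abs_nonneg M₁) hlog
    have h8 := mul_nonneg (abs_nonneg M₂) hlog
    rw [abs_le, add_mul]
    constructor <;> linarith
  filter_upwards [ae_all_iff.2 key] with ω hω ε hε
  obtain ⟨j, hj⟩ := exists_nat_one_div_lt hε
  obtain ⟨M, hM, h⟩ := hω j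
  exact ⟨M, hM, fun N n => (h N n).trans (by gcongr)⟩

end Fluctuations

end PhiDim

/-! ### Geometry of the Moran set -/

namespace PhiDim

namespace IFSFamily

variable {K : ℕ} {𝒜 : Type*} [MeasurableSpace 𝒜] (𝓘 : IFSFamily K 𝒜)

section Cylinders

lemma a_pos (i : Fin K) (v : 𝒜) : 0 < 𝓘.a i v := 𝓘.A_pos.trans_le (𝓘.A_le_a i v)

lemma K_pos (𝓘 : IFSFamily K 𝒜) : 0 < K := two_pos.trans_le 𝓘.two_le_K

lemma B_pos : 0 < 𝓘.B :=
  (mul_pos (Nat.cast_pos.2 𝓘.K_pos) 𝓘.A_pos).trans_le 𝓘.K_mul_A_le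

lemma A_lt_one : 𝓘.A < 1 := by
  have h1 : (2 : ℝ) ≤ K := by exact_mod_cast 𝓘.two_le_K
  nlinarith [𝓘.K_mul_A_le, 𝓘.B_lt_one, 𝓘.A_pos]

lemma τ_lt_one : 𝓘.τ < 1 := by
  have h1 : (2 : ℝ) ≤ K := by exact_mod_cast 𝓘.two_le_K
  have h2 := 𝓘.τ_le
  rw [le_div_iff₀ (by linarith)] at h2
  nlinarith [𝓘.B_pos, 𝓘.τ_pos]

/-- The length of the Moran interval of step `n` with address `w`. -/
def cylLength (u : ℕ → 𝒜) (w : ℕ → Fin K) (n : ℕ) : ℝ := ∏ k ∈ Finset.range n, 𝓘.a (w k) (u k)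

variable (u : ℕ → 𝒜) (w : ℕ → Fin K)

lemma cylLength_pos (n : ℕ) : 0 < 𝓘.cylLength u w n := Finset.prod_pos fun _ _ => 𝓘.a_pos _ _

lemma cylLength_succ (n : ℕ) :
    𝓘.cylLength u w (n + 1) = 𝓘.cylLength u w n * 𝓘.a (w n) (u n) :=
  Finset.prod_range_succ _ _

lemma cylLength_add_le (N n : ℕ) :
    𝓘.cylLength u w (N + n) ≤ 𝓘.B ^ n * 𝓘.cylLength u w N := by
  induction n with
  | zero => simp
  | succ n ih =>
    rw [← add_assoc, cylLength_succ, pow_succ, mul_right_comm]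
    exact mul_le_mul ih (𝓘.a_le _ _) (𝓘.a_nonneg _ _)
      (mul_nonneg (pow_nonneg 𝓘.B_pos.le _) (𝓘.cylLength_pos u w N).le)

lemma cylLength_le (n : ℕ) : 𝓘.cylLength u w n ≤ 𝓘.B ^ n := by
  simpa [cylLength] using 𝓘.cylLength_add_le u w 0 n

lemma cylLength_antitone : Antitone (𝓘.cylLength u w) :=
  antitone_nat_of_succ_le fun n => by
    rw [cylLength_succ]
    exact mul_le_of_le_one_right (𝓘.cylLength_pos u w n).le ((𝓘.a_le _ _).trans 𝓘.B_lt_one.le)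

/-- The step at which the lengths of the Moran intervals along an address pass below `ρ`. -/
lemma exists_cylLength_stopping {ρ : ℝ} (hρ : 0 < ρ) (hρ1 : ρ ≤ 1) :
    ∃ n, ρ ≤ 𝓘.cylLength u w n ∧ 𝓘.cylLength u w (n + 1) < ρ ∧
      𝓘.A * 𝓘.cylLength u w n ≤ 𝓘.cylLength u w (n + 1) := by
  classical
  have hex : ∃ n, 𝓘.cylLength u w n < ρ := by
    obtain ⟨n, hn⟩ := exists_pow_lt_of_lt_one hρ 𝓘.B_lt_one
    exact ⟨n, (𝓘.cylLength_le u w n).trans_lt hn⟩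
  obtain ⟨n, hn⟩ : ∃ n, Nat.find hex = n + 1 := by
    refine Nat.exists_eq_succ_of_ne_zero fun h0 => ?_
    have := Nat.find_spec hex
    rw [h0] at this
    simp only [cylLength, Finset.range_zero, Finset.prod_empty] at this
    linarith
  refine ⟨n, not_lt.1 (Nat.find_min hex (by omega)), hn ▸ Nat.find_spec hex, ?_⟩
  rw [cylLength_succ, mul_comm]
  exact mul_le_mul_of_nonneg_left (𝓘.A_le_a _ _) (𝓘.cylLength_pos u w n).le

lemma dist_compMap_address (n : ℕ) (x y : ℝ) :
    dist (𝓘.compMap u n (fun k => w k) x) (𝓘.compMap u n (fun k => w k) y)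
      = 𝓘.cylLength u w n * dist x y := by
  rw [𝓘.dist_compMap, cylLength, Finset.prod_range]

lemma exists_address {x : ℝ} (hx : x ∈ 𝓘.moranSet u) :
    ∃ w : ℕ → Fin K, ∀ n, x ∈ 𝓘.moranInterval u n (fun k => w k) := by
  choose W hW using fun n => mem_iUnion.1 (mem_iInter.1 hx n)
  refine ⟨fun n => W (n + 1) (Fin.last n), fun n => ?_⟩
  suffices h : (fun k : Fin n => W (k + 1) (Fin.last k)) = W n by rw [h]; exact hW n
  induction n with
  | zero => exact Subsingleton.elim _ _
  | succ n ih =>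
    have h1 := 𝓘.eq_of_mem_moranInterval u n _ _ x
      (𝓘.moranInterval_succ_subset u n _ (hW (n + 1))) (hW n)
    rw [← Fin.snoc_init_self (W (n + 1)), h1, ← ih]
    funext k
    refine Fin.lastCases ?_ (fun j => ?_) k
    · simp
    · simp

lemma point_mem_moranSet : 𝓘.point u w ∈ 𝓘.moranSet u :=
  mem_iInter.2 fun n => mem_iUnion.2 ⟨_, 𝓘.point_mem u w n⟩

lemma isCompact_moranSet : IsCompact (𝓘.moranSet u) := by
  have h : ∀ n, IsCompact (⋃ w : Fin n → Fin K, 𝓘.moranInterval u n w) := fun n =>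
    isCompact_iUnion fun w => 𝓘.isCompact_moranInterval u n w
  exact (h 0).of_isClosed_subset (isClosed_iInter fun n => (h n).isClosed) (iInter_subset _ 0)

variable {u w}

lemma dist_le_cylLength {n : ℕ} {x y : ℝ} (hx : x ∈ 𝓘.moranInterval u n (fun k => w k))
    (hy : y ∈ 𝓘.moranInterval u n (fun k => w k)) : dist x y ≤ 𝓘.cylLength u w n := by
  obtain ⟨x', hx', rfl⟩ := hx
  obtain ⟨y', hy', rfl⟩ := hy
  rw [dist_compMap_address]
  refine mul_le_of_le_one_right (𝓘.cylLength_pos u w n).le ?_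
  rw [Real.dist_eq, abs_le]
  constructor <;> linarith [hx'.1, hx'.2, hy'.1, hy'.2]

/-- Uniform strong separation: points of the Moran set closer to `x` than `τ` times the length of a
Moran interval around `x` lie in that interval. -/
lemma mem_moranInterval_of_dist_lt {x y : ℝ} (hx : ∀ n, x ∈ 𝓘.moranInterval u n (fun k => w k))
    (hy : y ∈ 𝓘.moranSet u) (n : ℕ) (h : dist x y < 𝓘.τ * 𝓘.cylLength u w n) :
    y ∈ 𝓘.moranInterval u n (fun k => w k) := by
  obtain ⟨v, hv⟩ := 𝓘.exists_address u hy
  induction n with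
  | zero =>
    convert hv 0 using 1
    congr 1
    exact Subsingleton.elim _ _
  | succ n ih =>
    have hlt : dist x y < 𝓘.τ * 𝓘.cylLength u w n := h.trans_le
      (mul_le_mul_of_nonneg_left (𝓘.cylLength_antitone u w n.le_succ) 𝓘.τ_pos.le)
    have hvw := 𝓘.eq_of_mem_moranInterval u n _ _ y (hv n) (ih hlt)
    have hn : v n = w n := by
      by_contra hne
      obtain ⟨x', hx', hxx⟩ := hx (n + 1)
      obtain ⟨y', hy', hyy⟩ := hv (n + 1)
      have hxx' : 𝓘.compMap u n (fun k => w k) (𝓘.S (w n) (u n) x') = x := hxx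
      have hyy' : 𝓘.compMap u n (fun k => v k) (𝓘.S (v n) (u n) y') = y := hyy
      rw [hvw] at hyy'
      rw [← hxx', ← hyy', dist_compMap_address, mul_comm] at hlt
      have h1 := lt_of_mul_lt_mul_right hlt (𝓘.cylLength_pos u w n).le
      exact absurd (𝓘.separated (u n) _ _ (Ne.symm hne) x' hx' y' hy') (not_le.2 h1)
    have hvw' : (fun k : Fin (n + 1) => v k) = fun k : Fin (n + 1) => w k := by
      funext k
      refine Fin.lastCases ?_ (fun j => ?_) k
      · simpa using hn
      · simpa using congrFun hvw j
    rw [← hvw']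
    exact hv (n + 1)

end Cylinders

section MoranMeasure

variable (l : ℕ → 𝒜 × Weights K)

lemma moranMeasure_compl_moranSet : 𝓘.moranMeasure l (𝓘.moranSet fun n => (l n).1)ᶜ = 0 := by
  rw [moranMeasure, Measure.map_apply (𝓘.measurable_point _)
    (𝓘.isCompact_moranSet _).isClosed.measurableSet.compl]
  exact measure_mono_null (fun w hw => (hw (𝓘.point_mem_moranSet _ w)).elim) measure_empty

lemma moranMeasure_real_moranInterval (w : ℕ → Fin K) (n : ℕ) :
    (𝓘.moranMeasure l).real (𝓘.moranInterval (fun m => (l m).1) n fun k => w k)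
      = ∏ k ∈ Finset.range n, (l k).2.1 (w k) := by
  rw [measureReal_def, moranMeasure_moranInterval, ENNReal.toReal_prod, Finset.prod_range]
  exact Finset.prod_congr rfl fun k _ => ENNReal.toReal_ofReal ((l k).2.2.1 _)

variable {l} {w : ℕ → Fin K} {x : ℝ}

lemma moranMeasure_ball_le (hx : ∀ n, x ∈ 𝓘.moranInterval (fun m => (l m).1) n fun k => w k)
    {n : ℕ} {R : ℝ} (hR : R ≤ 𝓘.τ * 𝓘.cylLength (fun m => (l m).1) w n) :
    (𝓘.moranMeasure l).real (Metric.ball x R)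
      ≤ (𝓘.moranMeasure l).real (𝓘.moranInterval (fun m => (l m).1) n fun k => w k) := by
  refine ENNReal.toReal_mono (measure_ne_top _ _) ?_
  rw [← measure_inter_conull (𝓘.moranMeasure_compl_moranSet l)]
  refine measure_mono fun y hy => 𝓘.mem_moranInterval_of_dist_lt hx hy.2 n ?_
  rw [dist_comm]
  exact (Metric.mem_ball.1 hy.1).trans_le hR

lemma le_moranMeasure_ball (hx : ∀ n, x ∈ 𝓘.moranInterval (fun m => (l m).1) n fun k => w k)
    {n : ℕ} {R : ℝ} (hR : 𝓘.cylLength (fun m => (l m).1) w n < R) :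
    (𝓘.moranMeasure l).real (𝓘.moranInterval (fun m => (l m).1) n fun k => w k)
      ≤ (𝓘.moranMeasure l).real (Metric.ball x R) :=
  measureReal_mono fun _ hy => (𝓘.dist_le_cylLength hy (hx n)).trans_lt hR

variable (l) in
lemma support_moranMeasure (hl : ∀ n i, 0 < (l n).2.1 i) :
    (𝓘.moranMeasure l).support = 𝓘.moranSet fun n => (l n).1 := by
  refine subset_antisymm (Measure.support_subset_of_isClosed (𝓘.isCompact_moranSet _).isClosed
    (𝓘.moranMeasure_compl_moranSet l)) fun x hx => ?_
  obtain ⟨w, hw⟩ := 𝓘.exists_address _ hx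
  refine (Measure.mem_support_iff_forall x).2 fun U hU => ?_
  obtain ⟨r, hr, hrU⟩ := Metric.mem_nhds_iff.1 hU
  obtain ⟨n, hn⟩ := exists_pow_lt_of_lt_one hr 𝓘.B_lt_one
  have h1 := 𝓘.le_moranMeasure_ball hw ((𝓘.cylLength_le (fun m => (l m).1) w n).trans_lt hn)
  rw [moranMeasure_real_moranInterval] at h1
  have h2 : 0 < (𝓘.moranMeasure l).real (Metric.ball x r) :=
    (Finset.prod_pos fun k _ => hl k (w k)).trans_le h1
  exact (ENNReal.toReal_pos_iff.1 h2).1.trans_le (measure_mono hrU)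

end MoranMeasure

end IFSFamily

end PhiDim

/-! ### Log-regularity of the natural measure -/

namespace PhiDim

namespace IFSFamily

variable {K : ℕ} {𝒜 : Type*} [MeasurableSpace 𝒜] (𝓘 : IFSFamily K 𝒜)

/-- The pressure `log ∑ᵢ a(i,v)^x` of the iterated function system with parameter `v`. -/
noncomputable def pressure (x : ℝ) (v : 𝒜) : ℝ := Real.log (∑ i, 𝓘.a i v ^ x)

lemma sum_rpow_pos (x : ℝ) (v : 𝒜) : 0 < ∑ i, 𝓘.a i v ^ x := by
  have : Nonempty (Fin K) := ⟨⟨0, 𝓘.K_pos⟩⟩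
  exact Finset.sum_pos (fun i _ => Real.rpow_pos_of_pos (𝓘.a_pos i v) x) Finset.univ_nonempty

/-- The natural weights `a(i,v)^x / ∑ⱼ a(j,v)^x`. -/
noncomputable def naturalWeight (x : ℝ) (v : 𝒜) : Weights K :=
  ⟨fun i => 𝓘.a i v ^ x / ∑ j, 𝓘.a j v ^ x,
    fun i => div_nonneg (Real.rpow_nonneg (𝓘.a_nonneg i v) x) (𝓘.sum_rpow_pos x v).le, by
      rw [← Finset.sum_div, div_self (𝓘.sum_rpow_pos x v).ne']⟩

lemma naturalWeight_apply (x : ℝ) (v : 𝒜) (i : Fin K) :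
    (𝓘.naturalWeight x v).1 i = 𝓘.a i v ^ x * Real.exp (-𝓘.pressure x v) := by
  rw [pressure, Real.exp_neg, Real.exp_log (𝓘.sum_rpow_pos x v), ← div_eq_mul_inv]
  rfl

lemma naturalWeight_pos (x : ℝ) (v : 𝒜) (i : Fin K) : 0 < (𝓘.naturalWeight x v).1 i :=
  div_pos (Real.rpow_pos_of_pos (𝓘.a_pos i v) x) (𝓘.sum_rpow_pos x v)

/-- The natural measure of exponent `x` on the Moran set. -/
noncomputable def naturalMeasure (x : ℝ) (u : ℕ → 𝒜) : Measure ℝ :=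
  𝓘.moranMeasure fun n => (u n, 𝓘.naturalWeight x (u n))

instance (x : ℝ) (u : ℕ → 𝒜) : IsProbabilityMeasure (𝓘.naturalMeasure x u) :=
  inferInstanceAs (IsProbabilityMeasure (𝓘.moranMeasure _))

lemma support_naturalMeasure (x : ℝ) (u : ℕ → 𝒜) :
    (𝓘.naturalMeasure x u).support = 𝓘.moranSet u :=
  𝓘.support_moranMeasure _ fun n i => 𝓘.naturalWeight_pos x (u n) i

variable (D : ℝ) (u : ℕ → 𝒜) (w : ℕ → Fin K)

lemma naturalMeasure_real_moranInterval (n : ℕ) :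
    (𝓘.naturalMeasure D u).real (𝓘.moranInterval u n fun k => w k)
      = 𝓘.cylLength u w n ^ D * Real.exp (-∑ k ∈ Finset.range n, 𝓘.pressure D (u k)) := by
  have h := 𝓘.moranMeasure_real_moranInterval (fun n => (u n, 𝓘.naturalWeight D (u n))) w n
  simp only [naturalWeight_apply] at h
  rw [Finset.prod_mul_distrib, ← Real.exp_sum, Finset.sum_neg_distrib,
    Real.finsetProd_rpow _ _ fun k _ => 𝓘.a_nonneg _ _] at h
  exact h

lemma naturalMeasure_real_moranInterval_add (N n : ℕ) :
    (𝓘.naturalMeasure D u).real (𝓘.moranInterval u N fun k => w k)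
      = (𝓘.cylLength u w N / 𝓘.cylLength u w (N + n)) ^ D
        * Real.exp (∑ k ∈ Finset.range n, 𝓘.pressure D (u (N + k)))
        * (𝓘.naturalMeasure D u).real (𝓘.moranInterval u (N + n) fun k => w k) := by
  have h1 := 𝓘.cylLength_pos u w N
  have h2 := 𝓘.cylLength_pos u w (N + n)
  have h3 : 0 < 𝓘.cylLength u w (N + n) ^ D := by positivity
  rw [naturalMeasure_real_moranInterval, naturalMeasure_real_moranInterval,
    Finset.sum_range_add, rpow_div_eq h1 h2, neg_add, Real.exp_add,
    Real.exp_neg (∑ k ∈ Finset.range n, 𝓘.pressure D (u (N + k)))]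
  field_simp

/-- The logarithmic bound for the fluctuations of the pressures along `u`: the block of length `n`
after the time `N` sums to at most `ε n` plus a multiple of `log (N + 2)`. -/
def HasLogFluctuations : Prop :=
  ∀ ε > (0 : ℝ), ∃ M : ℝ, 0 ≤ M ∧ ∀ N n : ℕ,
    |∑ k ∈ Finset.range n, 𝓘.pressure D (u (N + k))| ≤ ε * n + M * Real.log (N + 2)

variable {D u}

/-- Since the lengths of the Moran intervals decrease geometrically, fluctuations `ε n` in the
exponent cost an arbitrarily small power of the ratio of the lengths. -/
lemma HasLogFluctuations.moranInterval_bounds (h : 𝓘.HasLogFluctuations D u) {ε : ℝ}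
    (hε : 0 < ε) : ∃ M : ℝ, 0 ≤ M ∧ ∀ (w : ℕ → Fin K) (N n : ℕ),
      (𝓘.naturalMeasure D u).real (𝓘.moranInterval u N fun k => w k)
        ≤ ((N : ℝ) + 2) ^ M * (𝓘.cylLength u w N / 𝓘.cylLength u w (N + n)) ^ (D + ε)
          * (𝓘.naturalMeasure D u).real (𝓘.moranInterval u (N + n) fun k => w k) ∧
      (𝓘.cylLength u w N / 𝓘.cylLength u w (N + n)) ^ (D - ε)
          * (𝓘.naturalMeasure D u).real (𝓘.moranInterval u (N + n) fun k => w k)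
        ≤ ((N : ℝ) + 2) ^ M * (𝓘.naturalMeasure D u).real (𝓘.moranInterval u N fun k => w k) := by
  have hβ : 0 < -Real.log 𝓘.B := neg_pos.2 (Real.log_neg 𝓘.B_pos 𝓘.B_lt_one)
  obtain ⟨M, hM, hb⟩ := h (ε * -Real.log 𝓘.B) (mul_pos hε hβ)
  refine ⟨M, hM, fun w N n => ?_⟩
  have hL := 𝓘.cylLength_pos u w N
  have hL' := 𝓘.cylLength_pos u w (N + n)
  set Q := 𝓘.cylLength u w N / 𝓘.cylLength u w (N + n) with hQ
  have hQ0 : 0 < Q := div_pos hL hL'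
  have hN : (0 : ℝ) < N + 2 := by positivity
  have hn : n * -Real.log 𝓘.B ≤ Real.log Q := by
    have h1 : 1 ≤ 𝓘.B ^ n * Q := by
      rw [hQ, mul_div_assoc', le_div_iff₀ hL', one_mul]
      exact 𝓘.cylLength_add_le u w N n
    have h2 := Real.log_nonneg h1
    rw [Real.log_mul (pow_pos 𝓘.B_pos n).ne' hQ0.ne', Real.log_pow] at h2
    linarith
  have hS := hb N n
  set S := ∑ k ∈ Finset.range n, 𝓘.pressure D (u (N + k)) with hSdef
  have hS' : |S| ≤ ε * Real.log Q + M * Real.log (N + 2) := by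
    refine hS.trans (add_le_add ?_ le_rfl)
    rw [mul_assoc, mul_comm (-Real.log 𝓘.B)]
    exact mul_le_mul_of_nonneg_left hn hε.le
  have hexp : Real.exp (ε * Real.log Q + M * Real.log (N + 2)) = Q ^ ε * ((N : ℝ) + 2) ^ M := by
    rw [Real.exp_add, Real.rpow_def_of_pos hQ0, Real.rpow_def_of_pos hN, mul_comm ε, mul_comm M]
  have hm := measureReal_nonneg (μ := 𝓘.naturalMeasure D u)
    (s := 𝓘.moranInterval u (N + n) fun k => w k)
  have e1 : Real.exp S ≤ Q ^ ε * ((N : ℝ) + 2) ^ M := by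
    rw [← hexp, Real.exp_le_exp]
    exact (le_abs_self S).trans hS'
  have e2 : 1 ≤ Q ^ ε * ((N : ℝ) + 2) ^ M * Real.exp S := by
    rw [← hexp, ← Real.exp_add]
    refine Real.one_le_exp ?_
    linarith [neg_abs_le S]
  rw [naturalMeasure_real_moranInterval_add 𝓘 D u w N n, ← hQ, ← hSdef]
  set m := (𝓘.naturalMeasure D u).real (𝓘.moranInterval u (N + n) fun k => w k)
  constructor
  · rw [Real.rpow_add hQ0]
    calc Q ^ D * Real.exp S * m ≤ Q ^ D * (Q ^ ε * ((N : ℝ) + 2) ^ M) * m := by gcongr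
      _ = _ := by ring
  · have e : Q ^ D = Q ^ (D - ε) * Q ^ ε := by rw [← Real.rpow_add hQ0, sub_add_cancel]
    calc Q ^ (D - ε) * m = Q ^ (D - ε) * m * 1 := (mul_one _).symm
      _ ≤ Q ^ (D - ε) * m * (Q ^ ε * ((N : ℝ) + 2) ^ M * Real.exp S) := by gcongr
      _ = _ := by rw [e]; ring

/-- The step `N` of a Moran interval is at most logarithmic in its length; the summand `3` leaves
room for the step `N + 1`. -/
lemma exists_add_three_le_log : ∃ c : ℝ, 1 ≤ c ∧ ∀ (u : ℕ → 𝒜) (w : ℕ → Fin K) (N : ℕ) (R : ℝ),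
    0 < R → R < 1 → R ≤ 𝓘.cylLength u w N → (N : ℝ) + 3 ≤ c * (1 + |Real.log R|) := by
  have hβ : 0 < -Real.log 𝓘.B := neg_pos.2 (Real.log_neg 𝓘.B_pos 𝓘.B_lt_one)
  have hβ' : 0 < (-Real.log 𝓘.B)⁻¹ := inv_pos.2 hβ
  refine ⟨(-Real.log 𝓘.B)⁻¹ + 3, by linarith, fun u w N R hR hR1 hRN => ?_⟩
  have h1 := Real.log_le_log hR (hRN.trans (𝓘.cylLength_le u w N))
  rw [Real.log_pow] at h1
  have h2 : N * -Real.log 𝓘.B ≤ |Real.log R| := by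
    rw [abs_of_neg (Real.log_neg hR hR1)]
    linarith
  rw [← le_div_iff₀ hβ, div_eq_mul_inv] at h2
  nlinarith [abs_nonneg (Real.log R)]

theorem HasLogFluctuations.isLogRegular_naturalMeasure (h : 𝓘.HasLogFluctuations D u)
    (hD : 0 < D) : IsLogRegular (𝓘.naturalMeasure D u) D := by
  intro ε₀ hε₀
  -- a smaller error only strengthens the bounds, and makes the exponent `D - ε` nonnegative
  set ε := min ε₀ D with hεdef
  have hε : 0 < ε := lt_min hε₀ hD
  have hεD : 0 ≤ D - ε := sub_nonneg.2 (min_le_right _ _)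
  obtain ⟨M, hM, hb⟩ := h.moranInterval_bounds 𝓘 hε
  obtain ⟨c, hc, hlog⟩ := 𝓘.exists_add_three_le_log
  have hA := 𝓘.A_pos
  have hA1 := 𝓘.A_lt_one
  have hτ := 𝓘.τ_pos
  have hτ1 := 𝓘.τ_lt_one
  -- the cost of replacing balls by Moran intervals, at both ends of the range of radii
  set κ := (𝓘.τ * 𝓘.A ^ 2)⁻¹ with hκ
  have hκ1 : 1 ≤ κ := by
    rw [hκ]
    exact (one_le_inv₀ (by positivity)).2 (mul_le_one₀ hτ1.le (by positivity)
      (pow_le_one₀ hA.le hA1.le))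
  have hcM : 1 ≤ c ^ M := Real.one_le_rpow hc hM
  have hκD : κ ^ (D - ε) ≤ κ ^ (D + ε) := Real.rpow_le_rpow_of_exponent_le hκ1 (by linarith)
  refine ⟨M, hM, κ ^ (D + ε) * c ^ M, by positivity, 𝓘.τ, hτ, hτ1.le, ?_⟩
  intro x hx r R hr hrR hRτ
  rw [support_naturalMeasure] at hx
  obtain ⟨w, hw⟩ := 𝓘.exists_address u hx
  have hR : 0 < R := hr.trans_le hrR
  have hR1 : R < 1 := hRτ.trans hτ1
  have hRr1 : 1 ≤ R / r := (one_le_div hr).2 hrR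
  have hRr : 0 < R / r := by linarith
  set L := 𝓘.cylLength u w with hL
  have hLpos : ∀ n, 0 < L n := 𝓘.cylLength_pos u w
  have hLanti : Antitone L := 𝓘.cylLength_antitone u w
  set ν := 𝓘.naturalMeasure D u with hν
  -- from here on only the masses of balls and of Moran intervals matter
  obtain ⟨m, hm⟩ : ∃ m : ℕ → ℝ, ∀ n, ν.real (𝓘.moranInterval u n fun k => w k) = m n :=
    ⟨_, fun _ => rfl⟩
  obtain ⟨b, hbR⟩ : ∃ b : ℝ → ℝ, ∀ R, ν.real (Metric.ball x R) = b R := ⟨_, fun _ => rfl⟩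
  have hm0 : ∀ n, 0 ≤ m n := fun n => hm n ▸ measureReal_nonneg
  have hb0 : ∀ R, 0 ≤ b R := fun R => hbR R ▸ measureReal_nonneg
  have hbmono : b r ≤ b R := by
    rw [← hbR, ← hbR]
    exact measureReal_mono (Metric.ball_subset_ball hrR)
  have hball_le : ∀ {n : ℕ} {R : ℝ}, R ≤ 𝓘.τ * L n → b R ≤ m n := fun {n R} hR => by
    rw [← hbR, ← hm]
    exact 𝓘.moranMeasure_ball_le (l := fun n => (u n, 𝓘.naturalWeight D (u n))) hw hR
  have hle_ball : ∀ {n : ℕ} {R : ℝ}, L n < R → m n ≤ b R := fun {n R} hR => by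
    rw [← hbR, ← hm]
    exact 𝓘.le_moranMeasure_ball (l := fun n => (u n, 𝓘.naturalWeight D (u n))) hw hR
  replace hb := hb w
  simp only [hm, ← hL] at hb
  rw [hbR, hbR]
  have hbr := hb0 r
  have hbR' := hb0 R
  have hpow : ∀ {N : ℕ}, (N : ℝ) + 2 ≤ c * (1 + |Real.log R|) →
      ((N : ℝ) + 2) ^ M ≤ c ^ M * (1 + |Real.log R|) ^ M := fun hN => by
    rw [← Real.mul_rpow (by linarith) (by positivity)]
    exact Real.rpow_le_rpow (by positivity) hN hM
  constructor
  -- the part of the Moran set in `B(x,R)` lies in `I_N`, while `B(x,r)` contains `I_{N'+1}`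
  · obtain ⟨N, hN1, hN2, hN3⟩ := 𝓘.exists_cylLength_stopping u w (ρ := R / 𝓘.τ) (by positivity)
      ((div_le_one hτ).2 hRτ.le)
    obtain ⟨N', hN1', hN2', hN3'⟩ := 𝓘.exists_cylLength_stopping u w hr (hrR.trans hR1.le)
    have hRRτ : R ≤ R / 𝓘.τ := by
      rw [le_div_iff₀ hτ]
      exact mul_le_of_le_one_right hR.le hτ1.le
    have hNN' : N < N' + 1 := by
      by_contra! hcon
      have := hLanti hcon
      linarith
    obtain ⟨n, hn⟩ := Nat.exists_eq_add_of_le hNN'.le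
    have hQ : L N / L (N + n) ≤ κ * (R / r) := by
      rw [← hn, div_le_iff₀ (hLpos _), hκ]
      have h1 : L N * 𝓘.A ≤ R / 𝓘.τ := by linarith
      have h2 : 𝓘.A * r ≤ L (N' + 1) := (mul_le_mul_of_nonneg_left hN1' hA.le).trans hN3'
      calc L N ≤ R / 𝓘.τ / 𝓘.A := by rwa [le_div_iff₀ hA]
        _ = (𝓘.τ * 𝓘.A ^ 2)⁻¹ * (R / r) * (𝓘.A * r) := by field_simp
        _ ≤ _ := by gcongr
    have hQ0 : 0 < L N / L (N + n) := div_pos (hLpos _) (hLpos _)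
    have hNlog := hlog u w N R hR hR1 (hRRτ.trans hN1)
    have hm1 := hm0 (N + n)
    calc b R
        ≤ m N :=
          hball_le (by rw [div_le_iff₀ hτ] at hN1; linarith)
      _ ≤ ((N : ℝ) + 2) ^ M * (L N / L (N + n)) ^ (D + ε) * m (N + n) := (hb N n).1
      _ ≤ (c ^ M * (1 + |Real.log R|) ^ M) * (κ * (R / r)) ^ (D + ε) * b r := by
          gcongr
          · exact hpow (by linarith)
          · exact hle_ball (hn ▸ hN2')
      _ = κ ^ (D + ε) * c ^ M * (1 + |Real.log R|) ^ M * (R / r) ^ (D + ε) * b r := by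
          rw [Real.mul_rpow (by positivity) hRr.le]; ring
      _ ≤ _ := by
          gcongr
          exact min_le_left _ _
  -- `B(x,R)` contains `I_{N₀+1}`, while the part of the Moran set in `B(x,r)` lies in `I_{N'}`
  · have hfinal : (R / r) ^ (D - ε) * b r
        ≤ κ ^ (D + ε) * c ^ M * (1 + |Real.log R|) ^ M * b R := by
      obtain ⟨N₀, hN1, hN2, hN3⟩ := 𝓘.exists_cylLength_stopping u w hR hR1.le
      obtain ⟨N', hN1', hN2', hN3'⟩ := 𝓘.exists_cylLength_stopping u w (ρ := r / 𝓘.τ)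
        (by positivity) ((div_le_one hτ).2 (hrR.trans hRτ.le))
      have hNlog := hlog u w N₀ R hR hR1 hN1
      have hrτ : 𝓘.A * L N' < r / 𝓘.τ := hN3'.trans_lt hN2'
      rw [lt_div_iff₀ hτ] at hrτ
      have hlog1 : 1 ≤ (1 + |Real.log R|) ^ M :=
        Real.one_le_rpow (by linarith [abs_nonneg (Real.log R)]) hM
      rcases le_or_gt (N₀ + 1) N' with hNN | hNN
      · obtain ⟨n, rfl⟩ := Nat.exists_eq_add_of_le hNN
        have hAR : 𝓘.A * R ≤ L (N₀ + 1) := (mul_le_mul_of_nonneg_left hN1 hA.le).trans hN3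
        have hQ : R / r ≤ κ * (L (N₀ + 1) / L (N₀ + 1 + n)) := by
          rw [hκ, div_le_iff₀ hr]
          have h0 := hLpos (N₀ + 1 + n)
          have h0' := hLpos (N₀ + 1)
          calc R = (𝓘.τ * 𝓘.A ^ 2)⁻¹ * (𝓘.A * R / L (N₀ + 1 + n))
                * (𝓘.A * L (N₀ + 1 + n) * 𝓘.τ) := by field_simp
            _ ≤ (𝓘.τ * 𝓘.A ^ 2)⁻¹ * (L (N₀ + 1) / L (N₀ + 1 + n)) * r := by gcongr
        have hQ0 : 0 < L (N₀ + 1) / L (N₀ + 1 + n) := div_pos (hLpos _) (hLpos _)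
        have hm1 := hm0 (N₀ + 1 + n)
        have hm2 := hm0 (N₀ + 1)
        calc (R / r) ^ (D - ε) * b r
            ≤ (κ * (L (N₀ + 1) / L (N₀ + 1 + n))) ^ (D - ε) * m (N₀ + 1 + n) := by
              gcongr
              exact hball_le (by rw [div_le_iff₀ hτ] at hN1'; linarith)
          _ = κ ^ (D - ε) * ((L (N₀ + 1) / L (N₀ + 1 + n)) ^ (D - ε) * m (N₀ + 1 + n)) := by
              rw [Real.mul_rpow (by positivity) hQ0.le, mul_assoc]
          _ ≤ κ ^ (D + ε) * ((((N₀ + 1 : ℕ) : ℝ) + 2) ^ M * m (N₀ + 1)) :=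
              mul_le_mul hκD (hb (N₀ + 1) n).2 (by positivity) (by positivity)
          _ ≤ κ ^ (D + ε) * ((c ^ M * (1 + |Real.log R|) ^ M) * b R) := by
              gcongr
              · exact hpow (by push_cast; linarith)
              · exact hle_ball hN2
          _ = _ := by ring
      · -- here `r` and `R` are comparable
        have hLR : R ≤ L N' := hN1.trans (hLanti (by omega))
        have hRrκ : R / r ≤ κ := by
          rw [hκ, div_le_iff₀ hr]
          calc R = (𝓘.τ * 𝓘.A)⁻¹ * (𝓘.A * R * 𝓘.τ) := by field_simp
            _ ≤ (𝓘.τ * 𝓘.A ^ 2)⁻¹ * r := by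
              gcongr
              · rw [sq]; exact mul_le_of_le_one_left hA.le hA1.le
              · exact le_trans (by gcongr) hrτ.le
        have h1 : (R / r) ^ (D - ε) ≤ κ ^ (D + ε) * c ^ M * (1 + |Real.log R|) ^ M := by
          calc (R / r) ^ (D - ε) ≤ κ ^ (D - ε) := by gcongr
            _ ≤ κ ^ (D + ε) := hκD
            _ ≤ κ ^ (D + ε) * (c ^ M * (1 + |Real.log R|) ^ M) :=
              le_mul_of_one_le_right (by positivity) (one_le_mul_of_one_le_of_one_le hcM hlog1)
            _ = _ := by ring
        gcongr
    refine le_trans ?_ hfinal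
    gcongr
    exact min_le_left _ _

end IFSFamily

end PhiDim

/-! ### Pressure, the natural law, and admissible laws -/

namespace PhiDim

namespace IFSFamily

variable {K : ℕ} {𝒜 : Type*} [MeasurableSpace 𝒜] (𝓘 : IFSFamily K 𝒜)

section Pressure

lemma measurable_pressure (x : ℝ) : Measurable (𝓘.pressure x) := by
  have := 𝓘.measurable_a
  exact Real.measurable_log.comp (Finset.measurable_fun_sum _ fun i _ => (this i).pow_const x)

lemma pressure_zero (v : 𝒜) : 𝓘.pressure 0 v = Real.log K := by simp [pressure]

lemma pressure_le {x y : ℝ} (h : x ≤ y) (v : 𝒜) :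
    𝓘.pressure y v ≤ 𝓘.pressure x v + (y - x) * Real.log 𝓘.B := by
  have hB := 𝓘.B_pos
  rw [← Real.log_rpow hB, pressure, pressure,
    ← Real.log_mul (𝓘.sum_rpow_pos x v).ne' (by positivity)]
  refine Real.log_le_log (𝓘.sum_rpow_pos y v) ?_
  rw [Finset.sum_mul]
  refine Finset.sum_le_sum fun i _ => ?_
  have ha := 𝓘.a_pos i v
  have e : 𝓘.a i v ^ y = 𝓘.a i v ^ x * 𝓘.a i v ^ (y - x) := by
    rw [← Real.rpow_add ha, add_sub_cancel]
  rw [e]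
  gcongr
  exact 𝓘.a_le i v

lemma le_pressure {x y : ℝ} (h : x ≤ y) (v : 𝒜) :
    𝓘.pressure x v + (y - x) * Real.log 𝓘.A ≤ 𝓘.pressure y v := by
  have hA := 𝓘.A_pos
  rw [← Real.log_rpow hA, pressure, pressure,
    ← Real.log_mul (𝓘.sum_rpow_pos x v).ne' (by positivity)]
  refine Real.log_le_log (mul_pos (𝓘.sum_rpow_pos x v) (by positivity)) ?_
  rw [Finset.sum_mul]
  refine Finset.sum_le_sum fun i _ => ?_
  have ha := 𝓘.a_pos i v
  have e : 𝓘.a i v ^ y = 𝓘.a i v ^ x * 𝓘.a i v ^ (y - x) := by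
    rw [← Real.rpow_add ha, add_sub_cancel]
  rw [e]
  gcongr
  exact 𝓘.A_le_a i v

lemma exists_pressure_mem_Icc (x : ℝ) : ∃ b c : ℝ, ∀ v, 𝓘.pressure x v ∈ Icc b c := by
  rcases le_total 0 x with hx | hx
  · refine ⟨Real.log K + (x - 0) * Real.log 𝓘.A, Real.log K + (x - 0) * Real.log 𝓘.B, fun v => ?_⟩
    have h1 := 𝓘.le_pressure hx v
    have h2 := 𝓘.pressure_le hx v
    rw [pressure_zero] at h1 h2
    exact ⟨h1, h2⟩
  · refine ⟨Real.log K - (0 - x) * Real.log 𝓘.B, Real.log K - (0 - x) * Real.log 𝓘.A, fun v => ?_⟩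
    have h1 := 𝓘.le_pressure hx v
    have h2 := 𝓘.pressure_le hx v
    rw [pressure_zero] at h1 h2
    exact ⟨by linarith, by linarith⟩

variable (Q : Measure 𝒜) [IsProbabilityMeasure Q]

lemma integrable_pressure (x : ℝ) : Integrable (𝓘.pressure x) Q := by
  obtain ⟨b, c, h⟩ := 𝓘.exists_pressure_mem_Icc x
  exact Integrable.of_mem_Icc b c (𝓘.measurable_pressure x).aemeasurable (ae_of_all _ h)

lemma integral_pressure_le {x y : ℝ} (h : x ≤ y) :
    ∫ v, 𝓘.pressure y v ∂Q ≤ ∫ v, 𝓘.pressure x v ∂Q + (y - x) * Real.log 𝓘.B := by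
  have := integral_mono (𝓘.integrable_pressure Q y)
    ((𝓘.integrable_pressure Q x).add (integrable_const ((y - x) * Real.log 𝓘.B)))
    (𝓘.pressure_le h)
  rwa [integral_add' (𝓘.integrable_pressure Q x) (integrable_const _), integral_const,
    probReal_univ, one_smul] at this

lemma le_integral_pressure {x y : ℝ} (h : x ≤ y) :
    ∫ v, 𝓘.pressure x v ∂Q + (y - x) * Real.log 𝓘.A ≤ ∫ v, 𝓘.pressure y v ∂Q := by
  have := integral_mono
    ((𝓘.integrable_pressure Q x).add (integrable_const ((y - x) * Real.log 𝓘.A)))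
    (𝓘.integrable_pressure Q y) (𝓘.le_pressure h)
  rwa [integral_add' (𝓘.integrable_pressure Q x) (integrable_const _), integral_const,
    probReal_univ, one_smul] at this

lemma strictAnti_integral_pressure : StrictAnti fun x => ∫ v, 𝓘.pressure x v ∂Q := fun x y h => by
  have h1 := 𝓘.integral_pressure_le Q h.le
  have h2 := mul_neg_of_pos_of_neg (sub_pos.2 h) (Real.log_neg 𝓘.B_pos 𝓘.B_lt_one)
  simp only
  linarith

lemma continuous_integral_pressure : Continuous fun x => ∫ v, 𝓘.pressure x v ∂Q := by
  have hA : 0 ≤ -Real.log 𝓘.A := neg_nonneg.2 (Real.log_neg 𝓘.A_pos 𝓘.A_lt_one).le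
  refine (LipschitzWith.of_le_add_mul (Real.toNNReal (-Real.log 𝓘.A)) fun x y => ?_).continuous
  rw [Real.coe_toNNReal _ hA, Real.dist_eq]
  rcases le_total x y with h | h
  · have h1 := 𝓘.le_integral_pressure Q h
    rw [abs_of_nonpos (sub_nonpos.2 h)]
    linarith
  · have h1 : ∫ v, 𝓘.pressure x v ∂Q ≤ ∫ v, 𝓘.pressure y v ∂Q :=
      (𝓘.strictAnti_integral_pressure Q).antitone h
    have h2 := mul_nonneg hA (abs_nonneg (x - y))
    linarith

lemma exists_integral_pressure_eq_zero : ∃ D, 0 < D ∧ ∫ v, 𝓘.pressure D v ∂Q = 0 := by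
  have h0 : 0 < ∫ v, 𝓘.pressure 0 v ∂Q := by
    simp only [pressure_zero, integral_const, probReal_univ, one_smul]
    exact Real.log_pos (by exact_mod_cast 𝓘.two_le_K)
  have h1 : ∫ v, 𝓘.pressure 1 v ∂Q ≤ 0 := by
    refine integral_nonpos fun v => Real.log_nonpos (𝓘.sum_rpow_pos 1 v).le ?_
    simpa using (𝓘.sum_a_le v).trans 𝓘.B_lt_one.le
  obtain ⟨D, hD, hD0⟩ := intermediate_value_Icc' zero_le_one
    (𝓘.continuous_integral_pressure Q).continuousOn ⟨h1, h0.le⟩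
  refine ⟨D, lt_of_le_of_ne hD.1 fun h => ?_, hD0⟩
  rw [← h] at hD0
  exact h0.ne' hD0

variable {Q} {D : ℝ}

/-- When the mean pressure vanishes, the pressures along a random sequence of parameters are
independent, bounded and centred. -/
theorem ae_hasLogFluctuations (hD : ∫ v, 𝓘.pressure D v ∂Q = 0) :
    ∀ᵐ u ∂(Measure.infinitePi fun _ : ℕ => Q), 𝓘.HasLogFluctuations D u := by
  obtain ⟨b, c, hbc⟩ := 𝓘.exists_pressure_mem_Icc D
  have hsub : ∀ k, ProbabilityTheory.HasSubgaussianMGF (𝓘.pressure D ∘ fun u : ℕ → 𝒜 => u k)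
      ((‖c - b‖₊ / 2) ^ 2) (Measure.infinitePi fun _ : ℕ => Q) := fun k => by
    refine ProbabilityTheory.HasSubgaussianMGF.of_map (measurable_pi_apply k).aemeasurable ?_
    rw [Measure.infinitePi_map_eval]
    exact ProbabilityTheory.hasSubgaussianMGF_of_mem_Icc_of_integral_eq_zero
      (𝓘.measurable_pressure D).aemeasurable (ae_of_all _ hbc) hD
  exact (ae_forall_exists_abs_sum_le (ProbabilityTheory.iIndepFun_infinitePi
    (X := fun _ => 𝓘.pressure D) fun _ => 𝓘.measurable_pressure D) hsub).mono fun u hu => hu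

end Pressure

section NaturalLaw

lemma measurable_naturalWeight (x : ℝ) : Measurable (𝓘.naturalWeight x) := by
  have := 𝓘.measurable_a
  refine Measurable.subtype_mk (measurable_pi_lambda _ fun i => ?_)
  exact ((this i).pow_const x).div (Finset.measurable_fun_sum _ fun j _ => (this j).pow_const x)

lemma exists_pos_le_naturalWeight (x : ℝ) :
    ∃ c > 0, ∀ v i, c ≤ (𝓘.naturalWeight x v).1 i := by
  obtain ⟨b, c, hbc⟩ := 𝓘.exists_pressure_mem_Icc x
  have hA := 𝓘.A_pos
  have hB := 𝓘.B_pos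
  refine ⟨min (𝓘.A ^ x) (𝓘.B ^ x) * Real.exp (-c), by positivity, fun v i => ?_⟩
  rw [naturalWeight_apply]
  have ha := 𝓘.a_pos i v
  gcongr
  · rcases le_total 0 x with hx | hx
    · exact (min_le_left _ _).trans (Real.rpow_le_rpow hA.le (𝓘.A_le_a i v) hx)
    · exact (min_le_right _ _).trans (Real.rpow_le_rpow_of_nonpos ha (𝓘.a_le i v) hx)
  · exact (hbc v).2

variable (Q : Measure 𝒜) [IsProbabilityMeasure Q]

/-- The law of the pair of a random parameter and its natural weights of exponent `x`. -/
noncomputable def naturalLaw (x : ℝ) : ProbabilityMeasure (𝒜 × Weights K) :=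
  ⟨Q.map fun v => (v, 𝓘.naturalWeight x v), Measure.isProbabilityMeasure_map
    (measurable_id.prodMk (𝓘.measurable_naturalWeight x)).aemeasurable⟩

lemma isAdmissible_naturalLaw (x : ℝ) : IsAdmissible Q (𝓘.naturalLaw Q x) := by
  have hg : Measurable fun v => (v, 𝓘.naturalWeight x v) :=
    measurable_id.prodMk (𝓘.measurable_naturalWeight x)
  refine ⟨?_, 1, one_pos, fun i => ?_⟩
  · rw [Measure.fst, naturalLaw, ProbabilityMeasure.coe_mk, Measure.map_map measurable_fst hg]
    exact Measure.map_id
  · obtain ⟨c, hc, hcp⟩ := 𝓘.exists_pos_le_naturalWeight x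
    rw [naturalLaw, ProbabilityMeasure.coe_mk]
    refine (lintegral_map_le _ _).trans_lt ?_
    refine (lintegral_mono (g := fun _ => ENNReal.ofReal c ^ (-1 : ℝ)) fun v => ?_).trans_lt ?_
    · simp only [ENNReal.rpow_neg_one, ENNReal.inv_le_inv]
      exact ENNReal.ofReal_le_ofReal (hcp v i)
    · rw [lintegral_const, measure_univ, mul_one, ENNReal.rpow_neg_one, ENNReal.inv_lt_top]
      exact ENNReal.ofReal_pos.2 hc

lemma ae_moranMeasure_eq_naturalMeasure (x : ℝ) :
    ∀ᵐ l ∂(Measure.infinitePi fun _ : ℕ => (𝓘.naturalLaw Q x : Measure (𝒜 × Weights K))),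
      𝓘.moranMeasure l = 𝓘.naturalMeasure x fun n => (l n).1 := by
  have hg : Measurable fun v => (v, 𝓘.naturalWeight x v) :=
    measurable_id.prodMk (𝓘.measurable_naturalWeight x)
  have h1 : ∀ᵐ q ∂(𝓘.naturalLaw Q x : Measure (𝒜 × Weights K)),
      q.2 = 𝓘.naturalWeight x q.1 := by
    rw [naturalLaw, ProbabilityMeasure.coe_mk]
    exact (ae_map_iff hg.aemeasurable (measurableSet_eq_fun measurable_snd
      ((𝓘.measurable_naturalWeight x).comp measurable_fst))).2 (ae_of_all _ fun _ => rfl)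
  have h2 := ae_all_iff.2 fun n : ℕ => (measurePreserving_eval_infinitePi
    (fun _ : ℕ => (𝓘.naturalLaw Q x : Measure (𝒜 × Weights K))) n).quasiMeasurePreserving.ae h1
  filter_upwards [h2] with l hl
  rw [naturalMeasure]
  congr 1
  funext n
  exact Prod.ext rfl (hl n)

end NaturalLaw

section Admissible

variable {Q : Measure 𝒜} {P : ProbabilityMeasure (𝒜 × Weights K)}

lemma ae_fst_of_ae [IsProbabilityMeasure Q] (hP : IsAdmissible Q P) {p : (ℕ → 𝒜) → Prop}
    (h : ∀ᵐ u ∂(Measure.infinitePi fun _ : ℕ => Q), p u) :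
    ∀ᵐ l ∂(Measure.infinitePi fun _ : ℕ => (P : Measure (𝒜 × Weights K))),
      p fun n => (l n).1 := by
  have hmap : (Measure.infinitePi fun _ : ℕ => (P : Measure (𝒜 × Weights K))).map
      (fun l n => (l n).1) = Measure.infinitePi fun _ : ℕ => Q := by
    rw [Measure.infinitePi_map_pi _ (f := fun _ => Prod.fst) fun _ => measurable_fst]
    congr! with n
    exact hP.1
  rw [← hmap] at h
  have hmeas : Measurable fun (l : ℕ → 𝒜 × Weights K) n => (l n).1 :=
    measurable_pi_lambda _ fun n => measurable_fst.comp (measurable_pi_apply n)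
  exact ae_of_ae_map hmeas.aemeasurable h

/-- The negative moments of an admissible law force all the weights to be positive. -/
lemma ae_weights_pos (hP : IsAdmissible Q P) :
    ∀ᵐ l ∂(Measure.infinitePi fun _ : ℕ => (P : Measure (𝒜 × Weights K))),
      ∀ n i, 0 < (l n).2.1 i := by
  obtain ⟨-, t, ht, hint⟩ := hP
  refine ae_all_iff.2 fun n => ae_all_iff.2 fun i => ?_
  have hmeas : Measurable fun q : 𝒜 × Weights K => q.2.1 i :=
    (measurable_pi_apply i).comp (measurable_subtype_coe.comp measurable_snd)
  have h1 : ∀ᵐ q ∂(P : Measure (𝒜 × Weights K)), 0 < q.2.1 i := by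
    filter_upwards [ae_lt_top (hmeas.ennreal_ofReal.pow_const (-t)) (hint i).ne] with q hq
    by_contra! hle
    rw [ENNReal.ofReal_of_nonpos hle, ENNReal.zero_rpow_of_neg (neg_neg_of_pos ht)] at hq
    exact lt_irrefl _ hq
  exact (measurePreserving_eval_infinitePi
    (fun _ : ℕ => (P : Measure (𝒜 × Weights K))) n).quasiMeasurePreserving.ae h1

end Admissible

end IFSFamily

end PhiDim

theorem mainTheorem3 {K : ℕ} {𝒜 : Type*} [MeasurableSpace 𝒜] (𝓘 : PhiDim.IFSFamily K 𝒜)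
    (Q : Measure 𝒜) [IsProbabilityMeasure Q] :
    ∃ D : ℝ,
      -- `D` is the unique solution of `E log ∑ᵢ a(i)^x = 0`
      (∀ x : ℝ, ∫ u, Real.log (∑ i, 𝓘.a i u ^ x) ∂Q = 0 ↔ x = D) ∧
      ∀ Φ : ℝ → ℝ, PhiDim.IsDimensionFunction Φ → PhiDim.IsLarge Φ →
        -- the dimensions of the random Moran set
        (∀ᵐ u ∂(Measure.infinitePi fun _ : ℕ => Q),
          PhiDim.upperDimSet Φ (𝓘.moranSet u) = D ∧
          PhiDim.lowerDimSet Φ (𝓘.moranSet u) = D ∧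
          (dimH (𝓘.moranSet u) : EReal) = D) ∧
        -- bounds for all associated random measures
        (∀ P : ProbabilityMeasure (𝒜 × PhiDim.Weights K), PhiDim.IsAdmissible Q P →
          ∀ᵐ l ∂(Measure.infinitePi fun _ : ℕ => (P : Measure (𝒜 × PhiDim.Weights K))),
            PhiDim.lowerDimMeasure Φ (𝓘.moranMeasure l) ≤ D ∧
            D ≤ PhiDim.upperDimMeasure Φ (𝓘.moranMeasure l)) ∧
        -- `D` is the maximum and the minimum, respectively, of the almost sure values
        IsGreatest {d : EReal | ∃ P : ProbabilityMeasure (𝒜 × PhiDim.Weights K),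
          PhiDim.IsAdmissible Q P ∧
          ∀ᵐ l ∂(Measure.infinitePi fun _ : ℕ => (P : Measure (𝒜 × PhiDim.Weights K))),
            PhiDim.lowerDimMeasure Φ (𝓘.moranMeasure l) = d} D ∧
        IsLeast {d : EReal | ∃ P : ProbabilityMeasure (𝒜 × PhiDim.Weights K),
          PhiDim.IsAdmissible Q P ∧
          ∀ᵐ l ∂(Measure.infinitePi fun _ : ℕ => (P : Measure (𝒜 × PhiDim.Weights K))),
            PhiDim.upperDimMeasure Φ (𝓘.moranMeasure l) = d} D := by
  obtain ⟨D, hD, hD0⟩ := 𝓘.exists_integral_pressure_eq_zero Q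
  have hcompact : ∀ u, IsCompact (𝓘.naturalMeasure D u).support := fun u =>
    (𝓘.support_naturalMeasure D u).symm ▸ 𝓘.isCompact_moranSet u
  have hreg : ∀ᵐ u ∂(Measure.infinitePi fun _ : ℕ => Q),
      PhiDim.IsLogRegular (𝓘.naturalMeasure D u) D :=
    (𝓘.ae_hasLogFluctuations hD0).mono fun u hu => hu.isLogRegular_naturalMeasure 𝓘 hD
  refine ⟨D, fun x => ⟨fun hx => (𝓘.strictAnti_integral_pressure Q).injective (hx.trans hD0.symm),
    fun hx => hx ▸ hD0⟩, fun Φ _ hΦ => ?_⟩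
  have hbounds : ∀ P : ProbabilityMeasure (𝒜 × PhiDim.Weights K), PhiDim.IsAdmissible Q P →
      ∀ᵐ l ∂(Measure.infinitePi fun _ : ℕ => (P : Measure (𝒜 × PhiDim.Weights K))),
        PhiDim.lowerDimMeasure Φ (𝓘.moranMeasure l) ≤ D ∧
        D ≤ PhiDim.upperDimMeasure Φ (𝓘.moranMeasure l) := fun P hP => by
    filter_upwards [PhiDim.IFSFamily.ae_fst_of_ae hP hreg, PhiDim.IFSFamily.ae_weights_pos hP]
      with l hl hpos
    have hsupp : (𝓘.moranMeasure l).support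
        = (𝓘.naturalMeasure D fun n => (l n).1).support := by
      rw [𝓘.support_moranMeasure l hpos, 𝓘.support_naturalMeasure]
    exact ⟨hl.lowerDimMeasure_le (hcompact _) hsupp hΦ, hl.le_upperDimMeasure (hcompact _) hsupp hΦ⟩
  have hnat : ∀ᵐ l ∂(Measure.infinitePi fun _ : ℕ =>
      (𝓘.naturalLaw Q D : Measure (𝒜 × PhiDim.Weights K))),
        PhiDim.lowerDimMeasure Φ (𝓘.moranMeasure l) = D ∧
        PhiDim.upperDimMeasure Φ (𝓘.moranMeasure l) = D := by
    filter_upwards [PhiDim.IFSFamily.ae_fst_of_ae (𝓘.isAdmissible_naturalLaw Q D) hreg,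
      𝓘.ae_moranMeasure_eq_naturalMeasure Q D] with l hl hle
    rw [hle]
    exact ⟨hl.lowerDimMeasure_eq (hcompact _) hΦ, hl.upperDimMeasure_eq (hcompact _) hΦ⟩
  have hadm := 𝓘.isAdmissible_naturalLaw Q D
  refine ⟨?_, hbounds, ⟨⟨𝓘.naturalLaw Q D, hadm, hnat.mono fun l h => h.1⟩, ?_⟩,
    ⟨𝓘.naturalLaw Q D, hadm, hnat.mono fun l h => h.2⟩, ?_⟩
  · filter_upwards [hreg] with u hu
    rw [← 𝓘.support_naturalMeasure D u]
    exact ⟨hu.upperDimSet_support (hcompact u) hΦ, hu.lowerDimSet_support (hcompact u) hΦ,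
      hu.dimH_support (hcompact u) hD⟩
  · rintro d ⟨P, hP, hd⟩
    obtain ⟨l, h1, h2⟩ := (hd.and (hbounds P hP)).exists
    exact h1 ▸ h2.1
  · rintro d ⟨P, hP, hd⟩
    obtain ⟨l, h1, h2⟩ := (hd.and (hbounds P hP)).exists
    exact h1 ▸ h2.2
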